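/- Let $G$ be a topological group and let $p\colon E\to X$ be a numerable principal $G$-bundle: $G$ acts continuously and freely on the right of $E$, $p$ is continuous and induces a bijection $E/G\to X$, and $X$ has an open cover $(U_i)$ admitting a subordinate locally finite partition of unity such that each $p^{-1}(U_i)$ is $G$-equivariantly homeomorphic over $U_i$ to $U_i\times G$. Let $EG$ be Milnor's infinite join: its points are the sequences $(t_jg_j)_{j\ge 0}$ with $t_j\in[0,1]$, almost all $t_j$ zero, $\sum_j t_j=1$, and $g_j\in G$ specified only when $t_j>0$. It carries the coarsest topology for which all the maps $\tau_i\colon EG\to[0,1]$, $(t_jg_j)\mapsto t_i$, and $\gamma_i\colon \tau_i^{-1}(]0,1])\to G$, $(t_jg_j)\mapsto g_i$, are continuous with open domains (the sets $\tau_i^{-1}(J)$ and $\gamma_i^{-1}(V)$, with $J$ and $V$ open, form a subbase), the right $G$-action $(t_jg_j)\cdot g=(t_jg_jg)$, and the base point $(1e,0,0,\dots)$, where $e$ is the neutral element of $G$. Let $\mathrm{Map}_G(E,EG)$ be the space of continuous $G$-equivariant maps $E\to EG$ with the compact-open topology. (1) The space $\mathrm{Map}_G(E,EG)$ is contractible.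 (2) Let $\tilde *\in E$ and put $*=p(\tilde *)$. If $X$ is locally compact and the inclusion $\{*\}\subset X$ is a cofibration (that is, it has the homotopy extension property), then the subspace $\mathrm{Map}^{\bullet}_G(E,EG)\subset \mathrm{Map}_G(E,EG)$ of those maps that send $\tilde *$ to the base point of $EG$ is weakly contractible: it is nonempty, and it is path-connected with all homotopy groups trivial. No Hausdorff condition is imposed; locally compact means that every point has a neighbourhood basis of compact sets (each open cover has a finite subcover). -/

import Mathlib

open Set Topology

/-! ### Principal bundles

A right action of `G` on `E` is an action of the opposite group `Gᵐᵒᵖ`;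
`z · g` is written `MulOpposite.op g • z`. -/

section Bundles

universe u v w

/-- `p : E → X` is a principal `G`-space over `X`: the map `p` is continuous, `G` acts freely on
the right of `E`, and `p` induces a (continuous) bijection `E / G → X`.  (Continuity of the action
is the class `ContinuousSMul Gᵐᵒᵖ E`.) -/
structure IsPrincipalSpace (G : Type u) {E : Type v} {X : Type w} [Group G]
    [TopologicalSpace E] [TopologicalSpace X] [MulAction Gᵐᵒᵖ E] (p : E → X) : Prop where
  continuous : Continuous p
  free : ∀ (z : E) (g : G), MulOpposite.op g • z = z → g = 1
  surjective : Function.Surjective p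
  fiber : ∀ z z' : E, p z = p z' ↔ ∃ g : G, MulOpposite.op g • z = z'

/-- `p` is trivial over `U`: there is a `G`-equivariant homeomorphism from `p ⁻¹' U` to `U × G`
over `U`, where `G` acts on `U × G` by right multiplication on the second factor. -/
def IsTrivialOver (G : Type u) {E : Type v} {X : Type w} [Group G] [TopologicalSpace G]
    [TopologicalSpace E] [TopologicalSpace X] [MulAction Gᵐᵒᵖ E] (p : E → X) (U : Set X) : Prop :=
  ∃ φ : (p ⁻¹' U) ≃ₜ (U × G),
    (∀ z : p ⁻¹' U, ((φ z).1 : X) = p z) ∧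
    ∀ (z : p ⁻¹' U) (g : G) (hz : MulOpposite.op g • (z : E) ∈ p ⁻¹' U),
      φ ⟨MulOpposite.op g • (z : E), hz⟩ = ((φ z).1, (φ z).2 * g)

/-- `p` is a numerable principal `G`-bundle: a principal `G`-space that is trivial over the members
of an open cover to which a locally finite partition of unity of `X` is subordinate. -/
structure IsNumerablePrincipalBundle (G : Type u) {E : Type v} {X : Type w} [Group G]
    [TopologicalSpace G] [TopologicalSpace E] [TopologicalSpace X] [MulAction Gᵐᵒᵖ E]
    (p : E → X) : Prop extends IsPrincipalSpace G p where
  numerable : ∃ (ι : Type w) (U : ι → Set X) (ρ : PartitionOfUnity ι X univ),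
    (∀ i, IsOpen (U i)) ∧ (⋃ i, U i) = univ ∧ (∀ i, IsTrivialOver G p (U i)) ∧ ρ.IsSubordinate U

end Bundles

/-! ### Milnor's universal space -/

/-- Milnor's space `EG`, the infinite join of copies of `G`.  A point is a sequence
`(t₀ g₀, t₁ g₁, …)` with `tⱼ ≥ 0`, almost all `tⱼ` zero, `∑ tⱼ = 1`, where `gⱼ ∈ G` is specified
(only) for the `j` with `tⱼ > 0`. -/
@[ext]
structure MilnorE (G : Type*) where
  t : ℕ → ℝ
  nonneg : ∀ i, 0 ≤ t i
  finite : (Function.support t).Finite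
  sum_eq_one : ∑ᶠ i, t i = 1
  g : ∀ i, 0 < t i → G

namespace MilnorE

/-- The coarsest topology for which all the maps `τᵢ = tᵢ : EG → [0, 1]` and
`γᵢ = gᵢ : τᵢ⁻¹ (]0, 1]) → G` are continuous (on open domains): the sets `τᵢ⁻¹ J` and `γᵢ⁻¹ V`,
with `J` and `V` open, form a subbase. -/
instance {G : Type*} [TopologicalSpace G] : TopologicalSpace (MilnorE G) :=
  TopologicalSpace.generateFrom
    ({S | ∃ (i : ℕ) (J : Set ℝ), IsOpen J ∧ S = {x | x.t i ∈ J}} ∪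
     {S | ∃ (i : ℕ) (V : Set G), IsOpen V ∧ S = {x | ∃ h : 0 < x.t i, x.g i h ∈ V}})

/-- The right action `(tⱼ gⱼ) · a = (tⱼ gⱼ a)`. -/
instance {G : Type*} [Group G] : MulAction Gᵐᵒᵖ (MilnorE G) where
  smul a x :=
    { t := x.t
      nonneg := x.nonneg
      finite := x.finite
      sum_eq_one := x.sum_eq_one
      g := fun i h => x.g i h * a.unop }
  one_smul x := by
    refine MilnorE.ext rfl (heq_of_eq ?_)
    funext i h
    exact mul_one _
  mul_smul a b x := by
    refine MilnorE.ext rfl (heq_of_eq ?_)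
    funext i h
    exact (mul_assoc _ _ _).symm

/-- The base point `(1e, 0, 0, …)`. -/
noncomputable def base (G : Type*) [Group G] : MilnorE G where
  t := fun i => if i = 0 then 1 else 0
  nonneg := fun i => by split_ifs <;> norm_num
  finite := (Set.finite_singleton 0).subset fun i hi => by
    by_contra h
    exact hi (if_neg h)
  sum_eq_one := by
    rw [finsum_eq_single _ 0 (fun i hi => if_neg hi), if_pos rfl]
  g := fun _ _ => 1

end MilnorE

/-! ### Spaces of equivariant maps -/

section Maps

/-- `Map_G(E, A)`: the continuous `G`-equivariant maps, with the (subspace topology of the)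
compact-open topology. -/
abbrev EquivariantMap (G E A : Type*) [Group G] [TopologicalSpace E] [TopologicalSpace A]
    [MulAction Gᵐᵒᵖ E] [MulAction Gᵐᵒᵖ A] : Type _ :=
  {f : C(E, A) // ∀ (g : G) (z : E), f (MulOpposite.op g • z) = MulOpposite.op g • f z}

/-- `Map•_G(E, A)`: the equivariant maps that send the base point `e` to the base point `a`, with
the subspace topology. -/
abbrev PointedEquivariantMap (G : Type*) {E A : Type*} [Group G] [TopologicalSpace E]
    [TopologicalSpace A] [MulAction Gᵐᵒᵖ E] [MulAction Gᵐᵒᵖ A] (e : E) (a : A) : Type _ :=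
  {f : EquivariantMap G E A // f.1 e = a}

end Maps

/-! ### Cofibrations and weak contractibility -/

/-- The inclusion of `A` in `X` is a (Hurewicz) cofibration: it has the homotopy extension
property.  Testing on spaces `Z` in the universe of `X` is no restriction, since the mapping
cylinder of the inclusion lives there. -/
def IsCofibrationInclusion.{u} {X : Type u} [TopologicalSpace X] (A : Set X) : Prop :=
  ∀ (Z : Type u) [TopologicalSpace Z] (f : C(X, Z)) (H : C(A × unitInterval, Z)),
    (∀ a : A, H (a, 0) = f a) →
    ∃ K : C(X × unitInterval, Z),
      (∀ x : X, K (x, 0) = f x) ∧ ∀ (a : A) (s : unitInterval), K (a, s) = H (a, s)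

/-- A space is weakly contractible if it is nonempty and all its homotopy groups (and its set `π₀`
of path components) are trivial, at every base point. -/
def IsWeaklyContractible (Y : Type*) [TopologicalSpace Y] : Prop :=
  Nonempty Y ∧ ∀ (n : ℕ) (y : Y), Subsingleton (HomotopyGroup.Pi n Y y)

/-! The space `EG` has room for two points side by side: moving the `j`-th coordinate to place `2 *
j` is equivariantly homotopic to the identity (`MilnorE.shift`), and this frees the odd places. With
`x` at the even and `y` at the odd places, weight can slide from `x` to `y` (`MilnorE.join`) without
combining two group elements in one place.

For (1), a numerable bundle admits an equivariant map `φ : E → EG`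
(`IsNumerablePrincipalBundle.nonempty_equivariantMap`): the possibly uncountable cover is regrouped
into countably many disjointly supported families, whose functions and trivializations give weights
and coordinates. Applying `shift` and then sliding to `φ` pointwise deforms every `f` to a map
independent of `f`. Continuity in `f` for the compact-open topology uses that `EG` is regular
(`ContinuousMap.continuous_prodMk_left`).

For (2), sliding must leave the base point fixed, so it is damped by an invariant function `l` with
`l e = 0`. This forgets `f` only where `l = 1`. The cofibration supplies an equivariant deformation
`D` of `E` rel `e` that at its end maps the region `l ≠ 1` into the fibre of `e`
(`IsNumerablePrincipalBundle.exists_deformation`). There `f ∘ D₁` is determined by `f e`, so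
precomposing with `D` and then sliding gives a constant map of the pointed mapping space. Local
compactness of `X` makes evaluation, hence precomposition with `D`, jointly continuous. The pointed
space is thus contractible, and a contraction that moves the base point still kills all homotopy
groups (`GenLoop.homotopic_of_contraction`). -/

namespace MilnorE

variable {G : Type*}

/-! ### Points of `EG` and their weights. -/

theorem hasSum_t (x : MilnorE G) : HasSum x.t 1 := by
  have h : Summable x.t := summable_of_hasFiniteSupport x.finite
  have := h.hasSum
  rwa [tsum_eq_finsum x.finite, x.sum_eq_one] at this

/-- The point with given weights and group coordinates. -/
def ofCoords (t : ℕ → ℝ) (g : ℕ → G) (h0 : ∀ i, 0 ≤ t i) (hf : (Function.support t).Finite)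
    (hs : HasSum t 1) : MilnorE G where
  t := t
  nonneg := h0
  finite := hf
  sum_eq_one := by rw [← tsum_eq_finsum (L := SummationFilter.unconditional ℕ) hf, hs.tsum_eq]
  g := fun i _ => g i

theorem isOpen_setOf_t_mem [TopologicalSpace G] (i : ℕ) {J : Set ℝ} (hJ : IsOpen J) :
    IsOpen {x : MilnorE G | x.t i ∈ J} :=
  TopologicalSpace.isOpen_generateFrom_of_mem (Or.inl ⟨i, J, hJ, rfl⟩)

theorem continuous_t [TopologicalSpace G] (i : ℕ) : Continuous fun x : MilnorE G => x.t i :=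
  continuous_def.2 fun _ hJ => isOpen_setOf_t_mem i hJ

/-! ### Redistributing the weights -/

/-- A column-stochastic matrix of finite columns, supported on and below the diagonal, with at most
one nonzero entry in each row. -/
structure IsRedistribution (w : ℕ → ℕ → ℝ) : Prop where
  nonneg : ∀ i j, 0 ≤ w i j
  hasSum : ∀ j, HasSum (fun i => w i j) 1
  finite : ∀ j, (Function.support fun i => w i j).Finite
  eq_zero : ∀ i j, i < j → w i j = 0
  unique : ∀ i j k, w i j ≠ 0 → w i k ≠ 0 → j = k

theorem finite_support_redistribute {w : ℕ → ℕ → ℝ} (hw : IsRedistribution w) (x : MilnorE G) :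
    (Function.support fun i => ∑ j ∈ Finset.range (i + 1), w i j * x.t j).Finite := by
  refine (x.finite.biUnion fun j _ => hw.finite j).subset fun i hi => ?_
  obtain ⟨j, -, hj⟩ := Finset.exists_ne_zero_of_sum_ne_zero hi
  exact mem_biUnion (right_ne_zero_of_mul hj) (left_ne_zero_of_mul hj)

theorem hasSum_redistribute {w : ℕ → ℕ → ℝ} (hw : IsRedistribution w) (x : MilnorE G) :
    HasSum (fun i => ∑ j ∈ Finset.range (i + 1), w i j * x.t j) 1 := by
  have h1 : HasSum (fun i => ∑ j ∈ x.finite.toFinset, w i j * x.t j)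
      (∑ j ∈ x.finite.toFinset, 1 * x.t j) :=
    hasSum_sum fun j _ => (hw.hasSum j).mul_right _
  have h2 : ∑ j ∈ x.finite.toFinset, 1 * x.t j = 1 := by
    simp only [one_mul]
    exact (hasSum_sum_of_ne_finset_zero fun j hj => by simpa using hj).unique x.hasSum_t
  rw [h2] at h1
  convert h1 using 2 with i
  -- Both sums are compared on the union of their index sets: the extra terms vanish by
  -- triangularity of `w` on one side, and because `x.t j = 0` on the other.
  refine (Finset.sum_subset_zero_on_sdiff (Finset.subset_union_left
    (s₂ := x.finite.toFinset)) ?_ fun _ _ => rfl).trans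
    (Finset.sum_subset_zero_on_sdiff Finset.subset_union_right ?_ fun _ _ => rfl).symm
  · intro j hj
    rw [Finset.mem_sdiff, Finset.mem_range] at hj
    rw [hw.eq_zero i j (by omega), zero_mul]
  · intro j hj
    rw [Finset.mem_sdiff, Set.Finite.mem_toFinset, Function.mem_support, not_not] at hj
    rw [hj.2, mul_zero]

/-! ### Group coordinates and the topology of `EG`. -/

section Group

variable [Group G]

/-- The `i`-th group coordinate, extended by `1` to the points where it is not specified. -/
noncomputable def coord (x : MilnorE G) (i : ℕ) : G :=
  open Classical in if h : 0 < x.t i then x.g i h else 1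

theorem coord_of_pos {x : MilnorE G} {i : ℕ} (h : 0 < x.t i) : x.coord i = x.g i h :=
  dif_pos h

theorem ext_coord {x y : MilnorE G} (ht : ∀ i, x.t i = y.t i)
    (hg : ∀ i, 0 < x.t i → x.coord i = y.coord i) : x = y := by
  obtain ⟨t, h0, hf, hs, g⟩ := x
  obtain ⟨t', h0', hf', hs', g'⟩ := y
  obtain rfl : t = t' := funext ht
  have : g = g' := by
    funext i h
    have := hg i h
    rwa [coord_of_pos h, coord_of_pos (show 0 < (MilnorE.mk t h0' hf' hs' g').t i from h)] at this
  subst this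
  rfl

@[simp] theorem smul_t (a : Gᵐᵒᵖ) (x : MilnorE G) (i : ℕ) : (a • x).t i = x.t i := rfl

theorem coord_smul (g : G) {x : MilnorE G} {i : ℕ} (h : 0 < x.t i) :
    (MulOpposite.op g • x).coord i = x.coord i * g := by
  rw [coord_of_pos h, coord_of_pos (x := MulOpposite.op g • x) h]
  rfl

theorem base_t (i : ℕ) : (base G).t i = if i = 0 then 1 else 0 := rfl

theorem coord_base_zero : (base G).coord 0 = 1 :=
  coord_of_pos (x := base G) (by simp [base_t])

section Topology

variable [TopologicalSpace G] {Y : Type*} [TopologicalSpace Y]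

theorem isOpen_setOf_coord_mem (i : ℕ) {V : Set G} (hV : IsOpen V) :
    IsOpen {x : MilnorE G | 0 < x.t i ∧ x.coord i ∈ V} := by
  have h : IsOpen {x : MilnorE G | ∃ h : 0 < x.t i, x.g i h ∈ V} :=
    TopologicalSpace.isOpen_generateFrom_of_mem (Or.inr ⟨i, V, hV, rfl⟩)
  convert h using 1
  ext x
  constructor
  · rintro ⟨h, hx⟩
    exact ⟨h, by rwa [coord_of_pos h] at hx⟩
  · rintro ⟨h, hx⟩
    exact ⟨h, by rwa [coord_of_pos h]⟩

theorem continuousAt_coord {i : ℕ} {x : MilnorE G} (h : 0 < x.t i) :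
    ContinuousAt (fun x : MilnorE G => x.coord i) x := by
  intro V hV
  obtain ⟨W, hWV, hW, hxW⟩ := mem_nhds_iff.1 hV
  refine Filter.mem_map.2 ?_
  filter_upwards [(isOpen_setOf_coord_mem i hW).mem_nhds ⟨h, hxW⟩] with y hy
  exact hWV hy.2

theorem continuousAt_of_coord {F : Y → MilnorE G} {y : Y}
    (ht : ∀ i, ContinuousAt (fun y => (F y).t i) y)
    (hg : ∀ i, 0 < (F y).t i → ContinuousAt (fun y => (F y).coord i) y) : ContinuousAt F y := by
  refine TopologicalSpace.tendsto_nhds_generateFrom_iff.2 ?_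
  rintro _ (⟨i, J, hJ, rfl⟩ | ⟨i, V, hV, rfl⟩) hy
  · exact ht i (hJ.mem_nhds hy)
  · obtain ⟨h, hy⟩ := hy
    rw [← coord_of_pos h] at hy
    filter_upwards [ht i (lt_mem_nhds h), hg i h (hV.mem_nhds hy)] with z hz hz'
    refine ⟨hz, ?_⟩
    rw [← coord_of_pos hz]
    exact hz'

theorem continuous_of_coord {F : Y → MilnorE G} (ht : ∀ i, Continuous fun y => (F y).t i)
    (hg : ∀ i y, 0 < (F y).t i → ContinuousAt (fun y => (F y).coord i) y) : Continuous F :=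
  continuous_iff_continuousAt.2 fun y =>
    continuousAt_of_coord (fun i => (ht i).continuousAt) fun i => hg i y

instance [IsTopologicalGroup G] : ContinuousSMul Gᵐᵒᵖ (MilnorE G) where
  continuous_smul := by
    refine continuous_of_coord (fun i => ?_) ?_
    · change Continuous fun q : Gᵐᵒᵖ × MilnorE G => q.2.t i
      exact (continuous_t i).comp continuous_snd
    rintro i ⟨a, x⟩ (h : 0 < x.t i)
    have h1 : ContinuousAt (fun q : Gᵐᵒᵖ × MilnorE G => q.2.coord i * q.1.unop) (a, x) :=
      ((continuousAt_coord h).comp_of_eq continuousAt_snd rfl).mul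
        (MulOpposite.continuous_unop.continuousAt.comp continuousAt_fst)
    refine h1.congr ?_
    have h2 : ∀ᶠ q : Gᵐᵒᵖ × MilnorE G in 𝓝 (a, x), 0 < q.2.t i :=
      continuousAt_snd.eventually ((continuous_t i).continuousAt.eventually (lt_mem_nhds h))
    filter_upwards [h2] with q hq
    exact (coord_smul q.1.unop hq).symm

/-- Closed neighbourhoods need only be found inside subbasic open sets, where they come from the
regularity of `ℝ` and of the topological group `G`; no separation axiom on `G` is involved. -/
instance [IsTopologicalGroup G] : RegularSpace (MilnorE G) := by
  refine RegularSpace.of_exists_mem_nhds_isClosed_subset fun x s hs => ?_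
  suffices h : ∀ S, S ∈ ({S | ∃ (i : ℕ) (J : Set ℝ), IsOpen J ∧ S = {x : MilnorE G | x.t i ∈ J}} ∪
      {S | ∃ (i : ℕ) (V : Set G), IsOpen V ∧ S = {x | ∃ h : 0 < x.t i, x.g i h ∈ V}}) → x ∈ S →
      ∃ t ∈ 𝓝 x, IsClosed t ∧ t ⊆ S by
    have h' : ((𝓝 x).lift' closure) ≤ 𝓝 x := by
      refine TopologicalSpace.tendsto_nhds_generateFrom_iff.2 fun S hS hx => ?_
      obtain ⟨t, ht, htc, htS⟩ := h S hS hx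
      refine Filter.mem_of_superset (Filter.mem_lift' ht) ?_
      rw [htc.closure_eq]
      exact htS
    obtain ⟨u, hu, hus⟩ := (Filter.mem_lift'_sets (monotone_closure _)).1 (h' hs)
    exact ⟨closure u, Filter.mem_of_superset hu subset_closure, isClosed_closure, hus⟩
  rintro _ (⟨i, J, hJ, rfl⟩ | ⟨i, V, hV, rfl⟩) hx
  · obtain ⟨K, hK, hKc, hKJ⟩ := exists_mem_nhds_isClosed_subset (hJ.mem_nhds hx)
    exact ⟨_, (continuous_t i).continuousAt hK, hKc.preimage (continuous_t i), fun y hy => hKJ hy⟩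
  · obtain ⟨h, hx⟩ := hx
    obtain ⟨K, hK, hKc, hKV⟩ := exists_mem_nhds_isClosed_subset (hV.mem_nhds hx)
    -- The domain of the coordinate is open but not closed in general; the bound by half the weight
    -- at `x` keeps the set away from its edge.
    refine ⟨{y | x.t i / 2 ≤ y.t i ∧ y.coord i ∈ K}, ?_, ?_, ?_⟩
    · rw [← coord_of_pos h] at hK
      filter_upwards [(continuous_t i).continuousAt.eventually (lt_mem_nhds (half_lt_self h)),
        continuousAt_coord h hK] with y hy hy'
      exact ⟨le_of_lt hy, hy'⟩
    · rw [← isOpen_compl_iff]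
      convert (isOpen_setOf_t_mem (G := G) i (isOpen_Iio (a := x.t i / 2))).union
        (isOpen_setOf_coord_mem i hKc.isOpen_compl) using 1
      ext y
      simp only [mem_compl_iff, mem_ofPred_eq, mem_union, mem_Iio]
      constructor
      · intro hy
        by_cases hy' : y.t i < x.t i / 2
        · exact Or.inl hy'
        · exact Or.inr ⟨by linarith, fun hK => hy ⟨not_lt.1 hy', hK⟩⟩
      · rintro (hy | hy) ⟨h1, h2⟩
        · linarith
        · exact hy.2 h2
    · rintro y ⟨hy, hyK⟩
      have hy0 : 0 < y.t i := by linarith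
      exact ⟨hy0, hKV (by rwa [← coord_of_pos hy0])⟩

end Topology

/-! ### Redistribution as an equivariant continuous operation on `EG`. -/

/-- The column of the nonzero entry in the `i`-th row. -/
noncomputable def source (w : ℕ → ℕ → ℝ) (i : ℕ) : ℕ :=
  open Classical in if h : ∃ j, w i j ≠ 0 then h.choose else 0

theorem source_eq {w : ℕ → ℕ → ℝ} (hw : IsRedistribution w) {i j : ℕ} (h : w i j ≠ 0) :
    source w i = j := by
  have h' : ∃ j, w i j ≠ 0 := ⟨j, h⟩
  rw [source, dif_pos h']
  exact hw.unique _ _ _ h'.choose_spec h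

/-- The point obtained by distributing the weight `x.t j` over the places `i` in the proportions
`w i j`, keeping the group coordinate. -/
noncomputable def redistribute (w : ℕ → ℕ → ℝ) (hw : IsRedistribution w) (x : MilnorE G) :
    MilnorE G :=
  ofCoords (fun i => ∑ j ∈ Finset.range (i + 1), w i j * x.t j) (fun i => x.coord (source w i))
    (fun i => Finset.sum_nonneg fun j _ => mul_nonneg (hw.nonneg i j) (x.nonneg j))
    (finite_support_redistribute hw x) (hasSum_redistribute hw x)

theorem redistribute_t {w : ℕ → ℕ → ℝ} (hw : IsRedistribution w) (x : MilnorE G) (i : ℕ) :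
    (redistribute w hw x).t i = ∑ j ∈ Finset.range (i + 1), w i j * x.t j := rfl

theorem redistribute_t_eq {w : ℕ → ℕ → ℝ} (hw : IsRedistribution w) (x : MilnorE G) {i j : ℕ}
    (h : w i j ≠ 0) : (redistribute w hw x).t i = w i j * x.t j := by
  rw [redistribute_t]
  refine Finset.sum_eq_single j (fun k _ hk => ?_) fun hj => ?_
  · by_contra hne
    exact hk (hw.unique i k j (left_ne_zero_of_mul hne) h)
  · rw [hw.eq_zero i j (by rw [Finset.mem_range] at hj; omega), zero_mul]

theorem exists_source_of_pos {w : ℕ → ℕ → ℝ} (hw : IsRedistribution w) {x : MilnorE G} {i : ℕ}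
    (h : 0 < (redistribute w hw x).t i) :
    ∃ j, 0 < w i j ∧ 0 < x.t j ∧ (redistribute w hw x).coord i = x.coord j := by
  obtain ⟨j, -, hj⟩ := Finset.exists_ne_zero_of_sum_ne_zero (redistribute_t hw x i ▸ h.ne')
  refine ⟨j, (hw.nonneg i j).lt_of_ne' (left_ne_zero_of_mul hj),
    (x.nonneg j).lt_of_ne' (right_ne_zero_of_mul hj), ?_⟩
  exact (coord_of_pos h).trans (congrArg x.coord (source_eq hw (left_ne_zero_of_mul hj)))

theorem coord_redistribute {w : ℕ → ℕ → ℝ} (hw : IsRedistribution w) {x : MilnorE G} {i j : ℕ}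
    (hij : 0 < w i j) (hj : 0 < x.t j) : (redistribute w hw x).coord i = x.coord j := by
  have h : 0 < (redistribute w hw x).t i := by
    rw [redistribute_t_eq hw x hij.ne']
    positivity
  exact (coord_of_pos h).trans (congrArg x.coord (source_eq hw hij.ne'))

theorem redistribute_smul {w : ℕ → ℕ → ℝ} (hw : IsRedistribution w) (g : G) (x : MilnorE G) :
    redistribute w hw (MulOpposite.op g • x) = MulOpposite.op g • redistribute w hw x := by
  refine ext_coord (fun i => rfl) fun i h => ?_
  obtain ⟨j, hij, hj, h'⟩ := exists_source_of_pos hw h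
  rw [smul_t] at hj
  have h2 : 0 < (redistribute w hw x).t i := h
  rw [h', coord_smul g hj, coord_smul g h2, coord_redistribute hw hij hj]

/-- Triangularity makes each new weight a finite sum. Where it is positive, the unique source column
`j` stays the same nearby, so the new coordinate is locally the `j`-th coordinate of `x`. -/
theorem continuous_redistribute [TopologicalSpace G] {S : Type*} [TopologicalSpace S]
    {w : S → ℕ → ℕ → ℝ} (hw : ∀ s, IsRedistribution (w s))
    (hc : ∀ i j, Continuous fun s => w s i j) :
    Continuous fun q : S × MilnorE G => redistribute (w q.1) (hw q.1) q.2 := by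
  refine continuous_of_coord (fun i => ?_) fun i => ?_
  · simp only [redistribute_t]
    exact continuous_finsetSum _ fun j _ =>
      ((hc i j).comp continuous_fst).mul ((continuous_t j).comp continuous_snd)
  · rintro ⟨s, x⟩ h
    obtain ⟨j, hij, hj, -⟩ := exists_source_of_pos (hw s) h
    have h0 : ContinuousAt (fun q : S × MilnorE G => q.2.coord j) (s, x) :=
      ContinuousAt.comp (f := Prod.snd) (continuousAt_coord hj) continuousAt_snd
    refine h0.congr ?_
    have h1 : ∀ᶠ q : S × MilnorE G in 𝓝 (s, x), 0 < w q.1 i j :=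
      continuousAt_fst.eventually ((hc i j).continuousAt.eventually (lt_mem_nhds hij))
    have h2 : ∀ᶠ q : S × MilnorE G in 𝓝 (s, x), 0 < q.2.t j :=
      continuousAt_snd.eventually ((continuous_t j).continuousAt.eventually (lt_mem_nhds hj))
    filter_upwards [h1, h2] with q hq1 hq2
    exact (coord_redistribute (hw q.1) hq1 hq2).symm

end Group

end MilnorE

namespace MilnorE

/-! ### Moving to the even places -/

/-- A function decreasing from `1` on `[0, 2⁻ᵉ]` to `0` on `[2¹⁻ᵉ, ∞)`. -/
noncomputable def stage (e : ℕ) (s : ℝ) : ℝ := max 0 (min 1 (2 - 2 ^ e * s))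

theorem continuous_stage (e : ℕ) : Continuous (stage e) := by
  unfold stage
  fun_prop

theorem stage_nonneg (e : ℕ) (s : ℝ) : 0 ≤ stage e s := le_max_left _ _

theorem stage_le_one (e : ℕ) (s : ℝ) : stage e s ≤ 1 := max_le zero_le_one (min_le_left _ _)

theorem stage_zero_left {s : ℝ} (hs : s ≤ 1) : stage 0 s = 1 := by
  rw [stage, pow_zero, one_mul, min_eq_left (by linarith), max_eq_right zero_le_one]

theorem stage_zero_right (e : ℕ) : stage e 0 = 1 := by
  rw [stage, mul_zero, sub_zero, min_eq_left one_le_two, max_eq_right zero_le_one]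

theorem stage_succ_one (e : ℕ) : stage (e + 1) 1 = 0 := by
  have : (1 : ℝ) ≤ 2 ^ e := one_le_pow₀ one_le_two
  rw [stage, mul_one, pow_succ]
  exact max_eq_left ((min_le_right _ _).trans (by linarith))

theorem stage_antitone {s : ℝ} (hs : 0 ≤ s) : Antitone fun e => stage e s := by
  intro e f hef
  have : (2 : ℝ) ^ e ≤ 2 ^ f := pow_le_pow_right₀ one_le_two hef
  exact max_le_max le_rfl (min_le_min le_rfl (by nlinarith))

/-- The ramp of `stage e` lies over `[2⁻ᵉ, 2¹⁻ᵉ]`, so at any time at most one stage is strictly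
between `0` and `1`. -/
theorem stage_succ_eq_zero {e : ℕ} {s : ℝ} (h : stage e s < 1) : stage (e + 1) s = 0 := by
  have h1 : 2 - 2 ^ e * s < 1 := by
    by_contra hc
    rw [stage, min_eq_left (not_lt.1 hc), max_eq_right zero_le_one] at h
    exact lt_irrefl _ h
  rw [stage, pow_succ]
  exact max_eq_left ((min_le_right _ _).trans (by linarith))

/-- The weights of a deformation of the identity to the map that moves the `j`-th coordinate to
the place `2 * j`. -/
noncomputable def shiftWeight (s : ℝ) (i j : ℕ) : ℝ :=
  if i = j then stage j s
  else if j < i ∧ i ≤ 2 * j then stage (2 * j - i) s - stage (2 * j - i + 1) s else 0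

theorem continuous_shiftWeight (i j : ℕ) : Continuous fun s => shiftWeight s i j := by
  unfold shiftWeight
  split_ifs
  · exact continuous_stage j
  · exact (continuous_stage _).sub (continuous_stage _)
  · exact continuous_const

theorem shiftWeight_eq_zero {s : ℝ} {i j : ℕ} (h : i < j ∨ 2 * j < i) : shiftWeight s i j = 0 := by
  rw [shiftWeight, if_neg (by omega), if_neg (by omega)]

theorem shiftWeight_le {s : ℝ} {i j : ℕ} : shiftWeight s i j ≤ stage (2 * j - i) s := by
  unfold shiftWeight
  split_ifs with h
  · rw [show 2 * j - i = j by omega]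
  · exact sub_le_self _ (stage_nonneg _ _)
  · exact stage_nonneg _ _

/-- The column telescopes; for `n = j` it reaches `stage 0 s`, which is `1` on the interval. -/
theorem sum_shiftWeight (s : ℝ) (j n : ℕ) (hn : n ≤ j) :
    ∑ i ∈ Finset.range (j + 1 + n), shiftWeight s i j = stage (j - n) s := by
  induction n with
  | zero =>
    rw [add_zero, Finset.sum_range_succ, Finset.sum_eq_zero, zero_add, shiftWeight, if_pos rfl,
      Nat.sub_zero]
    intro i hi
    exact shiftWeight_eq_zero (Or.inl (Finset.mem_range.1 hi))
  | succ n ih =>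
    rw [← add_assoc, Finset.sum_range_succ, ih (by omega), shiftWeight, if_neg (by omega),
      if_pos (by omega), show 2 * j - (j + 1 + n) = j - (n + 1) by omega,
      show j - (n + 1) + 1 = j - n by omega]
    ring

/-- While `s` runs from `2⁻ᵉ` to `2¹⁻ᵉ`, each coordinate `j ≥ e` moves one step, from `2 * j - e` to
`2 * j - e + 1`, and those with `j < e` rest at place `j`. All these places are distinct, so no two
coordinates ever meet. Each `j` stays put for `s ≤ 2⁻ʲ`. -/
theorem isRedistribution_shiftWeight {s : ℝ} (h0 : 0 ≤ s) (h1 : s ≤ 1) :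
    IsRedistribution (shiftWeight s) where
  nonneg i j := by
    unfold shiftWeight
    split_ifs
    · exact stage_nonneg _ _
    · exact sub_nonneg.2 (stage_antitone h0 (Nat.le_succ _))
    · exact le_rfl
  hasSum j := by
    have h := sum_shiftWeight s j j le_rfl
    rw [Nat.sub_self, stage_zero_left h1] at h
    rw [← h]
    refine hasSum_sum_of_ne_finset_zero fun i hi => shiftWeight_eq_zero (Or.inr ?_)
    rw [Finset.mem_range] at hi
    omega
  finite j := (Set.finite_le_nat (2 * j)).subset fun i hi => by
    by_contra hc
    exact hi (shiftWeight_eq_zero (Or.inr (not_le.1 hc)))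
  eq_zero i j h := shiftWeight_eq_zero (Or.inl h)
  unique := by
    have key : ∀ i j k, j < k → shiftWeight s i j ≠ 0 → shiftWeight s i k = 0 := by
      intro i j k hjk hj
      by_contra hk
      have hki : k ≤ i := by
        by_contra hc
        exact hk (shiftWeight_eq_zero (Or.inl (not_le.1 hc)))
      have hij : i ≤ 2 * j := by
        by_contra hc
        exact hj (shiftWeight_eq_zero (Or.inr (not_le.1 hc)))
      rw [shiftWeight, if_neg (by omega), if_pos (by omega)] at hj
      have hlt : stage (2 * j - i + 1) s < 1 := by
        refine lt_of_le_of_ne (stage_le_one _ _) fun h => hj ?_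
        have := stage_antitone h0 (Nat.le_succ (2 * j - i))
        have h' := stage_le_one (2 * j - i) s
        simp only [Nat.succ_eq_add_one] at this
        linarith
      -- As `k > j`, the index `2 * k - i` is at least two above `2 * j - i`, past the one stage
      -- that can be in transition.
      have h2 : stage (2 * k - i) s ≤ 0 :=
        (stage_antitone h0 (by omega : 2 * j - i + 1 + 1 ≤ 2 * k - i)).trans
          (stage_succ_eq_zero hlt).le
      have h3 := shiftWeight_le (s := s) (i := i) (j := k)
      have h4 : 0 ≤ shiftWeight s i k := by
        rw [shiftWeight]
        split_ifs
        · exact stage_nonneg _ _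
        · exact sub_nonneg.2 (stage_antitone h0 (Nat.le_succ _))
        · exact le_rfl
      exact hk (le_antisymm (h3.trans h2) h4)
    intro i j k hj hk
    rcases lt_trichotomy j k with h | h | h
    · exact absurd (key i j k h hj) hk
    · exact h
    · exact absurd (key i k j h hk) hj

theorem shiftWeight_zero (i j : ℕ) : shiftWeight 0 i j = if i = j then 1 else 0 := by
  simp [shiftWeight, stage_zero_right]

theorem shiftWeight_one (i j : ℕ) : shiftWeight 1 i j = if i = 2 * j then 1 else 0 := by
  by_cases h : i = 2 * j
  · subst h
    rw [if_pos rfl, shiftWeight]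
    split_ifs with h1 h2
    · rw [show j = 0 by omega, stage_zero_left le_rfl]
    · rw [Nat.sub_self, stage_zero_left le_rfl, stage_succ_one, sub_zero]
    · omega
  · rw [if_neg h, shiftWeight]
    split_ifs with h1 h2
    · rw [show j = j - 1 + 1 by omega, stage_succ_one]
    · rw [show 2 * j - i = (2 * j - i - 1) + 1 by omega, stage_succ_one, stage_succ_one, sub_zero]
    · rfl

variable {G : Type*}

/-- The weights of the point that divides the line from `x`, placed at the even places, to `y`,
placed at the odd places, in the proportion `a : 1 - a`. -/
noncomputable def joinWeight (x y : MilnorE G) (a : ℝ) (i : ℕ) : ℝ :=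
  if Even i then (1 - a) * x.t (i / 2) else a * y.t (i / 2)

theorem joinWeight_even (x y : MilnorE G) (a : ℝ) (k : ℕ) :
    joinWeight x y a (2 * k) = (1 - a) * x.t k := by
  rw [joinWeight, if_pos (even_two_mul k), Nat.mul_div_cancel_left k two_pos]

theorem joinWeight_odd (x y : MilnorE G) (a : ℝ) (k : ℕ) :
    joinWeight x y a (2 * k + 1) = a * y.t k := by
  rw [joinWeight, if_neg (by simp), show (2 * k + 1) / 2 = k by omega]

theorem joinWeight_nonneg (x y : MilnorE G) (a : unitInterval) (i : ℕ) :
    0 ≤ joinWeight x y a i := by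
  unfold joinWeight
  split_ifs
  · exact mul_nonneg (sub_nonneg.2 a.2.2) (x.nonneg _)
  · exact mul_nonneg a.2.1 (y.nonneg _)

theorem finite_support_joinWeight (x y : MilnorE G) (a : ℝ) :
    (Function.support (joinWeight x y a)).Finite := by
  refine ((x.finite.image (2 * ·)).union (y.finite.image (2 * · + 1))).subset fun i hi => ?_
  rcases Nat.even_or_odd' i with ⟨k, rfl | rfl⟩
  · rw [Function.mem_support, joinWeight_even] at hi
    exact Or.inl ⟨k, right_ne_zero_of_mul hi, rfl⟩
  · rw [Function.mem_support, joinWeight_odd] at hi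
    exact Or.inr ⟨k, right_ne_zero_of_mul hi, rfl⟩

theorem hasSum_joinWeight (x y : MilnorE G) (a : ℝ) : HasSum (joinWeight x y a) 1 := by
  rw [show (1 : ℝ) = (1 - a) * 1 + a * 1 by ring]
  refine HasSum.even_add_odd ?_ ?_
  · simp only [joinWeight_even]
    exact x.hasSum_t.mul_left _
  · simp only [joinWeight_odd]
    exact y.hasSum_t.mul_left _

section Group

variable [Group G]

/-- A deformation of the identity of `EG` to the map that moves the `j`-th coordinate to the place
`2 * j`. -/
noncomputable def shift (s : unitInterval) (x : MilnorE G) : MilnorE G :=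
  redistribute (shiftWeight s) (isRedistribution_shiftWeight s.2.1 s.2.2) x

theorem continuous_shift [TopologicalSpace G] :
    Continuous fun q : unitInterval × MilnorE G => shift q.1 q.2 :=
  continuous_redistribute (fun s : unitInterval => isRedistribution_shiftWeight s.2.1 s.2.2)
    fun i j => (continuous_shiftWeight i j).comp continuous_subtype_val

theorem shift_smul (s : unitInterval) (g : G) (x : MilnorE G) :
    shift s (MulOpposite.op g • x) = MulOpposite.op g • shift s x :=
  redistribute_smul _ g x

theorem shift_zero (x : MilnorE G) : shift 0 x = x := by
  have hw : ∀ i, shiftWeight ((0 : unitInterval) : ℝ) i i = 1 := fun i => by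
    rw [Set.Icc.coe_zero, shiftWeight_zero, if_pos rfl]
  have ht : ∀ i, (shift 0 x).t i = x.t i := fun i => by
    rw [shift, redistribute_t_eq (j := i) _ _ (by rw [hw]; exact one_ne_zero), hw, one_mul]
  refine ext_coord ht fun i h => ?_
  rw [ht] at h
  exact coord_redistribute _ (by rw [hw]; exact one_pos) h

/-- Place `0` never moves because `2 * 0 = 0`; hence the deformation also acts on pointed maps. -/
theorem shift_base (s : unitInterval) : shift s (base G) = base G := by
  have hw : shiftWeight s 0 0 = 1 := by
    rw [shiftWeight, if_pos rfl, stage_zero_left s.2.2]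
  have ht : ∀ i, (shift s (base G)).t i = (base G).t i := fun i => by
    rcases Nat.eq_zero_or_pos i with rfl | hi
    · rw [shift, redistribute_t_eq (j := 0) _ _ (by rw [hw]; exact one_ne_zero), hw, one_mul]
    · rw [shift, redistribute_t, base_t, if_neg hi.ne']
      refine Finset.sum_eq_zero fun j _ => ?_
      rcases Nat.eq_zero_or_pos j with rfl | hj
      · rw [shiftWeight_eq_zero (Or.inr (by omega)), zero_mul]
      · rw [base_t, if_neg hj.ne', mul_zero]
  refine ext_coord ht fun i h => ?_
  have hi : i = 0 := by
    by_contra hc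
    rw [ht, base_t, if_neg hc] at h
    exact lt_irrefl _ h
  subst hi
  exact coord_redistribute _ (by rw [hw]; exact one_pos) (by simp [base_t])

/-! ### The join of two points -/

/-- The point that divides the line from `x`, placed at the even places, to `y`, placed at the odd
places, in the proportion `a : 1 - a`. -/
noncomputable def join (x y : MilnorE G) (a : unitInterval) : MilnorE G :=
  ofCoords (joinWeight x y a) (fun i => if Even i then x.coord (i / 2) else y.coord (i / 2))
    (joinWeight_nonneg x y a) (finite_support_joinWeight x y a) (hasSum_joinWeight x y a)

theorem join_t_even (x y : MilnorE G) (a : unitInterval) (k : ℕ) :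
    (join x y a).t (2 * k) = (1 - a) * x.t k := joinWeight_even x y a k

theorem join_t_odd (x y : MilnorE G) (a : unitInterval) (k : ℕ) :
    (join x y a).t (2 * k + 1) = a * y.t k := joinWeight_odd x y a k

theorem coord_join_even {x y : MilnorE G} {a : unitInterval} {k : ℕ}
    (h : 0 < (join x y a).t (2 * k)) : (join x y a).coord (2 * k) = x.coord k := by
  rw [coord_of_pos h]
  change (if Even (2 * k) then x.coord (2 * k / 2) else y.coord (2 * k / 2)) = _
  rw [if_pos (even_two_mul k), Nat.mul_div_cancel_left k two_pos]

theorem coord_join_odd {x y : MilnorE G} {a : unitInterval} {k : ℕ}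
    (h : 0 < (join x y a).t (2 * k + 1)) : (join x y a).coord (2 * k + 1) = y.coord k := by
  rw [coord_of_pos h]
  change (if Even (2 * k + 1) then x.coord ((2 * k + 1) / 2) else y.coord ((2 * k + 1) / 2)) = _
  rw [if_neg (by simp), show (2 * k + 1) / 2 = k by omega]

theorem pos_of_join_even {x y : MilnorE G} {a : unitInterval} {k : ℕ}
    (h : 0 < (join x y a).t (2 * k)) : 0 < x.t k := by
  rw [join_t_even] at h
  exact (x.nonneg k).lt_of_ne' (right_ne_zero_of_mul h.ne')

theorem pos_of_join_odd {x y : MilnorE G} {a : unitInterval} {k : ℕ}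
    (h : 0 < (join x y a).t (2 * k + 1)) : 0 < y.t k := by
  rw [join_t_odd] at h
  exact (y.nonneg k).lt_of_ne' (right_ne_zero_of_mul (ne_of_gt h))

/-- Criterion for a point to be a join. -/
theorem eq_join {x y z : MilnorE G} {a : unitInterval}
    (h0 : ∀ k, z.t (2 * k) = (1 - a) * x.t k) (h1 : ∀ k, z.t (2 * k + 1) = a * y.t k)
    (h0' : ∀ k, 0 < z.t (2 * k) → z.coord (2 * k) = x.coord k)
    (h1' : ∀ k, 0 < z.t (2 * k + 1) → z.coord (2 * k + 1) = y.coord k) : z = join x y a := by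
  have ht : ∀ i, z.t i = (join x y a).t i := fun i => by
    rcases Nat.even_or_odd' i with ⟨k, rfl | rfl⟩
    · rw [h0, join_t_even]
    · rw [h1, join_t_odd]
  refine ext_coord ht fun i h => ?_
  rcases Nat.even_or_odd' i with ⟨k, rfl | rfl⟩
  · rw [h0' k h, coord_join_even (by rwa [← ht])]
  · rw [h1' k h, coord_join_odd (by rwa [← ht])]

theorem join_smul (g : G) (x y : MilnorE G) (a : unitInterval) :
    MulOpposite.op g • join x y a = join (MulOpposite.op g • x) (MulOpposite.op g • y) a := by
  refine eq_join (fun k => join_t_even x y a k) (fun k => join_t_odd x y a k) (fun k h => ?_)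
    fun k h => ?_
  · rw [smul_t] at h
    rw [coord_smul g h, coord_join_even h, coord_smul g (pos_of_join_even h)]
  · rw [smul_t] at h
    rw [coord_smul g h, coord_join_odd h, coord_smul g (pos_of_join_odd h)]

theorem shift_one (x y : MilnorE G) : shift 1 x = join x y 0 := by
  have hw : ∀ k, shiftWeight ((1 : unitInterval) : ℝ) (2 * k) k = 1 := fun k => by
    rw [Set.Icc.coe_one, shiftWeight_one, if_pos rfl]
  have ht : ∀ k, (shift 1 x).t (2 * k) = x.t k := fun k => by
    rw [shift, redistribute_t_eq (j := k) _ _ (by rw [hw]; exact one_ne_zero), hw, one_mul]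
  have ht' : ∀ k, (shift 1 x).t (2 * k + 1) = 0 := fun k => by
    rw [shift, redistribute_t]
    refine Finset.sum_eq_zero fun j _ => ?_
    rw [Set.Icc.coe_one, shiftWeight_one, if_neg (by omega), zero_mul]
  refine eq_join (fun k => by simp [ht]) (fun k => by simp [ht']) (fun k h => ?_) fun k h => ?_
  · rw [ht] at h
    exact coord_redistribute _ (by rw [hw]; exact one_pos) h
  · exact absurd (ht' k) h.ne'

/-- All even weights vanish, and with them the coordinates of `x`. This is how dependence on the
given map disappears. -/
theorem join_one (x x' y : MilnorE G) : join x y 1 = join x' y 1 := by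
  refine eq_join (fun k => by simp [join_t_even]) (fun k => by simp [join_t_odd]) (fun k h => ?_)
    fun k h => coord_join_odd h
  simp [join_t_even] at h

theorem join_base (y : MilnorE G) : join (base G) y 0 = base G := by
  rw [← shift_one, shift_base]

theorem continuous_join [TopologicalSpace G] :
    Continuous fun q : MilnorE G × MilnorE G × unitInterval => join q.1 q.2.1 q.2.2 := by
  have ht : ∀ i, Continuous fun q : MilnorE G × MilnorE G × unitInterval =>
      (join q.1 q.2.1 q.2.2).t i := fun i => by
    rcases Nat.even_or_odd' i with ⟨k, rfl | rfl⟩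
    · simp only [join_t_even]
      exact (continuous_const.sub (continuous_subtype_val.comp
        (continuous_snd.comp continuous_snd))).mul ((continuous_t k).comp continuous_fst)
    · simp only [join_t_odd]
      exact (continuous_subtype_val.comp (continuous_snd.comp continuous_snd)).mul
        ((continuous_t k).comp (continuous_fst.comp continuous_snd))
  refine continuous_of_coord ht ?_
  rintro i ⟨x, y, a⟩ h
  have hev := (ht i).continuousAt.eventually (lt_mem_nhds h)
  rcases Nat.even_or_odd' i with ⟨k, rfl | rfl⟩
  · have h0 : ContinuousAt (fun q : MilnorE G × MilnorE G × unitInterval => q.1.coord k)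
        (x, y, a) :=
      ContinuousAt.comp (f := Prod.fst) (continuousAt_coord (pos_of_join_even h)) continuousAt_fst
    refine h0.congr ?_
    filter_upwards [hev] with q hq
    exact (coord_join_even hq).symm
  · have h0 : ContinuousAt (fun q : MilnorE G × MilnorE G × unitInterval => q.2.1.coord k)
        (x, y, a) :=
      ContinuousAt.comp (f := fun q : MilnorE G × MilnorE G × unitInterval => q.2.1)
        (continuousAt_coord (pos_of_join_odd h)) (continuous_fst.comp continuous_snd).continuousAt
    refine h0.congr ?_
    filter_upwards [hev] with q hq
    exact (coord_join_odd hq).symm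

end Group

end MilnorE

/-! ### Mapping spaces -/

/-- Pairing with a fixed map is continuous for the compact-open topologies if the target is
regular; no condition on the source is needed. -/
theorem ContinuousMap.continuous_prodMk_left {K Y Z : Type*} [TopologicalSpace K]
    [TopologicalSpace Y] [TopologicalSpace Z] [RegularSpace Y] (φ : C(K, Z)) :
    Continuous fun f : C(K, Y) => f.prodMk φ := by
  simp_rw [continuous_iff_continuousAt, ContinuousAt, ContinuousMap.tendsto_nhds_compactOpen]
  intro f C hC U hU hfU
  refine hC.induction_on (p := fun S => ∀ᶠ h : C(K, Y) in 𝓝 f, MapsTo (h.prodMk φ) S U) ?_ ?_ ?_ ?_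
  · exact Filter.Eventually.of_forall fun h => mapsTo_empty _ _
  · exact fun s t hst ht => ht.mono fun h hh => hh.mono_left hst
  · intro s t hs ht
    filter_upwards [hs, ht] with h h1 h2
    exact h1.union h2
  · intro k hk
    obtain ⟨V, W, hV, hW, hkV, hkW, hVW⟩ := isOpen_prod_iff.1 hU _ _ (hfU hk)
    obtain ⟨V', hV', hVc, hVV⟩ := exists_mem_nhds_isClosed_subset (hV.mem_nhds hkV)
    -- Since `V'` is closed, `C ∩ f ⁻¹' V'` is compact, so mapping it into `V` is an open condition
    -- on `h`; the fixed `φ` needs no compact set.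
    refine ⟨C ∩ (f ⁻¹' V' ∩ φ ⁻¹' W), inter_mem_nhdsWithin C (Filter.inter_mem
      (f.continuous.continuousAt hV') (φ.continuous.continuousAt (hW.mem_nhds hkW))), ?_⟩
    filter_upwards [ContinuousMap.eventually_mapsTo (f := f)
      (hC.inter_right (hVc.preimage f.continuous)) hV fun x hx => hVV hx.2] with h hh x hx
    exact hVW ⟨hh ⟨hx.1, hx.2.1⟩, hx.2.2⟩

/-! ### Contractible spaces are weakly contractible -/

section Cube

open unitInterval

/-- A homotopy from the identity of the interval to a map that sends its outer thirds to the
endpoints. -/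
noncomputable def stretch (s t : I) : I :=
  Set.projIcc (0 : ℝ) 1 zero_le_one ((1 + 2 * s) * (t - 1 / 2) + 1 / 2)

theorem continuous_stretch : Continuous fun q : I × I => stretch q.1 q.2 := by
  unfold stretch
  exact continuous_projIcc.comp (by fun_prop)

theorem stretch_zero (t : I) : stretch 0 t = t := by
  have : (1 + 2 * ((0 : I) : ℝ)) * (t - 1 / 2) + 1 / 2 = t := by
    rw [Set.Icc.coe_zero]
    ring
  rw [stretch, this, Set.projIcc_val]

theorem stretch_of_le {s t : I} (h : (1 + 2 * (s : ℝ)) * (t - 1 / 2) + 1 / 2 ≤ 0) :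
    stretch s t = 0 :=
  Set.projIcc_of_le_left _ h

theorem stretch_of_ge {s t : I} (h : 1 ≤ (1 + 2 * (s : ℝ)) * (t - 1 / 2) + 1 / 2) :
    stretch s t = 1 :=
  Set.projIcc_of_right_le _ h

theorem stretch_left (s : I) : stretch s 0 = 0 :=
  stretch_of_le (by rw [Set.Icc.coe_zero]; linarith [s.2.1])

theorem stretch_right (s : I) : stretch s 1 = 1 :=
  stretch_of_ge (by rw [Set.Icc.coe_one]; linarith [s.2.1])

/-- A function on the interval that vanishes at the endpoints and is `1` on the middle third. -/
noncomputable def plateau (t : I) : I :=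
  Set.projIcc (0 : ℝ) 1 zero_le_one (min (3 * t) (3 * (1 - t)))

theorem continuous_plateau : Continuous plateau := by
  unfold plateau
  exact continuous_projIcc.comp (by fun_prop)

theorem plateau_left : plateau 0 = 0 :=
  Set.projIcc_of_le_left _ (by simp)

theorem plateau_right : plateau 1 = 0 :=
  Set.projIcc_of_le_left _ (by simp)

/-- Hence a point of the cube either gets the full contraction time or is stretched to the boundary,
where a loop has a known value. -/
theorem plateau_eq_one_or (t : I) : plateau t = 1 ∨ stretch 1 t = 0 ∨ stretch 1 t = 1 := by
  by_cases h : (t : ℝ) ≤ 1 / 3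
  · exact Or.inr (Or.inl (stretch_of_le (by rw [Set.Icc.coe_one]; linarith)))
  · by_cases h' : 2 / 3 ≤ (t : ℝ)
    · exact Or.inr (Or.inr (stretch_of_ge (by rw [Set.Icc.coe_one]; linarith)))
    · exact Or.inl (Set.projIcc_of_right_le _ (le_min (by linarith) (by linarith)))

variable {Y : Type*} [TopologicalSpace Y]

/-- In a contractible space every generalized loop is homotopic to one that depends on the
contraction only. -/
theorem GenLoop.homotopic_of_contraction {n : ℕ} {y c : Y}
    (H : ContinuousMap.Homotopy (ContinuousMap.id Y) (ContinuousMap.const Y c))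
    (f g : GenLoop (Fin n) Y y) : GenLoop.Homotopic f g := by
  let τ : (Fin n → I) → I := fun x => ∏ i, plateau (x i)
  have hτ : Continuous τ :=
    continuous_finsetProd _ fun i _ => continuous_plateau.comp (continuous_apply i)
  have hτ0 : ∀ x ∈ Cube.boundary (Fin n), τ x = 0 := by
    rintro x ⟨i, hi⟩
    refine Finset.prod_eq_zero (Finset.mem_univ i) ?_
    rcases hi with hi | hi
    · rw [hi, plateau_left]
    · rw [hi, plateau_right]
  have hρ : Continuous fun q : I × (Fin n → I) => fun i => stretch q.1 (q.2 i) :=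
    continuous_pi fun i => continuous_stretch.comp
      (continuous_fst.prodMk ((continuous_apply i).comp continuous_snd))
  have hρb : ∀ (s : I), ∀ x ∈ Cube.boundary (Fin n),
      (fun i => stretch s (x i)) ∈ Cube.boundary (Fin n) := by
    rintro s x ⟨i, hi⟩
    refine ⟨i, ?_⟩
    rcases hi with hi | hi
    · exact Or.inl (by simp only [hi, stretch_left])
    · exact Or.inr (by simp only [hi, stretch_right])
  let k : C(Fin n → I, Y) := ⟨fun x => H (τ x, y), H.continuous.comp (hτ.prodMk continuous_const)⟩
  have hk : k ∈ GenLoop (Fin n) Y y := fun x hx => by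
    change H (τ x, y) = y
    rw [hτ0 x hx, H.apply_zero]
    rfl
  have key : ∀ f : GenLoop (Fin n) Y y, GenLoop.Homotopic f ⟨k, hk⟩ := by
    intro f
    have hs : Continuous fun q : I × (Fin n → I) => q.1 * τ q.2 :=
      continuous_fst.mul (hτ.comp continuous_snd)
    -- The contraction time `τ` vanishes on the boundary, so the homotopy is relative to it although
    -- `H` may move `y`. At the end, `f` contributes only its value `y` on the boundary or is
    -- contracted to `c`.
    refine ⟨⟨⟨⟨fun q => H (q.1 * τ q.2, f fun i => stretch q.1 (q.2 i)),
      H.continuous.comp (hs.prodMk (f.1.continuous.comp hρ))⟩, fun x => ?_, fun x => ?_⟩, ?_⟩⟩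
    · change H (0 * τ x, f fun i => stretch 0 (x i)) = f x
      simp only [zero_mul, stretch_zero, H.apply_zero]
      rfl
    · change H (1 * τ x, f fun i => stretch 1 (x i)) = H (τ x, y)
      rw [one_mul]
      by_cases hx : ∀ i, plateau (x i) = 1
      · have : τ x = 1 := Finset.prod_eq_one fun i _ => hx i
        rw [this, H.apply_one, H.apply_one]
        rfl
      · obtain ⟨i, hi⟩ := not_forall.1 hx
        rw [GenLoop.boundary f (fun i => stretch 1 (x i))
          ⟨i, (plateau_eq_one_or (x i)).resolve_left hi⟩]
    · intro s x hx
      change H (s * τ x, f fun i => stretch s (x i)) = f x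
      rw [hτ0 x hx, mul_zero, H.apply_zero, GenLoop.boundary f x hx,
        GenLoop.boundary f _ (hρb s x hx)]
      rfl
  exact (key f).trans (key g).symm

theorem ContractibleSpace.isWeaklyContractible [ContractibleSpace Y] : IsWeaklyContractible Y := by
  obtain ⟨c, ⟨H⟩⟩ := id_nullhomotopic Y
  refine ⟨⟨c⟩, fun n y => ⟨fun a b => ?_⟩⟩
  induction a using Quotient.inductionOn
  induction b using Quotient.inductionOn
  exact Quotient.sound (GenLoop.homotopic_of_contraction H _ _)

end Cube

/-! ### Equivariant maps to `EG` and local sections -/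

section Bundle

variable {G E X : Type*} [Group G] [TopologicalSpace G] [TopologicalSpace E] [MulAction Gᵐᵒᵖ E]

/-- An equivariant map to `EG` from its weights and its group coordinates. -/
theorem MilnorE.exists_equivariantMap (T : ℕ → E → ℝ) (θ : ℕ → E → G)
    (hT : ∀ n, Continuous (T n)) (h0 : ∀ n z, 0 ≤ T n z)
    (hf : ∀ z, (Function.support fun n => T n z).Finite) (hs : ∀ z, HasSum (fun n => T n z) 1)
    (hinv : ∀ n z (g : G), T n (MulOpposite.op g • z) = T n z)
    (hθ : ∀ n z, 0 < T n z → ContinuousAt (θ n) z)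
    (hθg : ∀ n z (g : G), 0 < T n z → θ n (MulOpposite.op g • z) = θ n z * g) :
    ∃ f : EquivariantMap G E (MilnorE G), (∀ z n, (f.1 z).t n = T n z) ∧
      ∀ z n, 0 < T n z → (f.1 z).coord n = θ n z := by
  let F : E → MilnorE G := fun z =>
    ofCoords (fun n => T n z) (fun n => θ n z) (fun n => h0 n z) (hf z) (hs z)
  have hF : ∀ z n, 0 < T n z → (F z).coord n = θ n z := fun z n h => coord_of_pos (x := F z) h
  refine ⟨⟨⟨F, continuous_of_coord hT fun n z h => ?_⟩, fun g z => ?_⟩, fun z n => rfl, hF⟩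
  · refine (hθ n z h).congr ?_
    filter_upwards [(hT n).continuousAt.eventually (lt_mem_nhds h)] with y hy
    exact (hF y n hy).symm
  · refine ext_coord (fun n => hinv n z g) fun n h => ?_
    have hz : 0 < T n z := (hinv n z g) ▸ h
    exact (hF _ n h).trans ((hθg n z g hz).trans
      ((congrArg (· * g) (hF z n hz).symm).trans (coord_smul g (x := F z) hz).symm))

variable [TopologicalSpace X] {p : E → X}

/-- A trivialization yields a local section `σ` and an equivariant map `θ` to the group with
`z = σ (p z) · θ z`. -/
theorem IsTrivialOver.exists_section (hp : IsPrincipalSpace G p) {U : Set X}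
    (hU : IsTrivialOver G p U) : ∃ (σ : X → E) (θ : E → G), ContinuousOn σ U ∧
      ContinuousOn θ (p ⁻¹' U) ∧ (∀ z (g : G), p z ∈ U → θ (MulOpposite.op g • z) = θ z * g) ∧
      (∀ x ∈ U, p (σ x) = x) ∧ ∀ z, p z ∈ U → MulOpposite.op (θ z) • σ (p z) = z := by
  classical
  obtain ⟨φ, hφ, hφg⟩ := hU
  have hpg : ∀ z (g : G), p (MulOpposite.op g • z) = p z := fun z g =>
    ((hp.fiber _ _).2 ⟨g, rfl⟩).symm
  let σ : X → E := fun x => if h : x ∈ U then φ.symm (⟨x, h⟩, 1) else (hp.surjective x).choose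
  let θ : E → G := fun z => if h : p z ∈ U then (φ ⟨z, h⟩).2 else 1
  have hσ : ∀ x (h : x ∈ U), σ x = φ.symm (⟨x, h⟩, 1) := fun x h => dif_pos h
  have hθ : ∀ z (h : p z ∈ U), θ z = (φ ⟨z, h⟩).2 := fun z h => dif_pos h
  have hpσ : ∀ x ∈ U, p (σ x) = x := fun x h => by
    rw [hσ x h, ← hφ, φ.apply_symm_apply]
  refine ⟨σ, θ, ?_, ?_, fun z g h => ?_, hpσ, fun z h => ?_⟩
  · rw [continuousOn_iff_continuous_domRestrict]
    refine (continuous_subtype_val.comp (φ.symm.continuous.comp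
      (continuous_id.prodMk continuous_const))).congr fun x => (hσ x x.2).symm
  · rw [continuousOn_iff_continuous_domRestrict]
    exact (continuous_snd.comp φ.continuous).congr fun z => (hθ z z.2).symm
  · have hz : p (MulOpposite.op g • z) ∈ U := (hpg z g).symm ▸ h
    rw [hθ _ hz, hθ z h, hφg ⟨z, h⟩ g hz]
  · have hx : p (σ (p z)) ∈ U := (hpσ _ h).symm ▸ h
    have hz : p (MulOpposite.op (θ z) • σ (p z)) ∈ U := (hpg _ _).symm ▸ hx
    have h1 : (⟨σ (p z), hx⟩ : p ⁻¹' U) = φ.symm (⟨p z, h⟩, 1) := Subtype.ext (hσ _ h)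
    have h2 : (⟨_, hz⟩ : p ⁻¹' U) = ⟨z, h⟩ := by
      apply φ.injective
      rw [hφg ⟨σ (p z), hx⟩ (θ z) hz, h1, φ.apply_symm_apply, one_mul, hθ z h]
      exact Prod.ext (Subtype.ext (hφ ⟨z, h⟩).symm) rfl
    exact congrArg Subtype.val h2

end Bundle

/-! ### From a numerable cover to an equivariant map to `EG` -/

namespace PartitionOfUnity

variable {ι X : Type*} [TopologicalSpace X] (ρ : PartitionOfUnity ι X univ)

theorem hasSum (x : X) : HasSum (fun i => ρ i x) 1 := by
  have hf : (Function.support fun i => ρ i x).Finite := ρ.locallyFinite.point_finite x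
  have hs : Summable fun i => ρ i x := summable_of_hasFiniteSupport hf
  have := hs.hasSum
  rwa [tsum_eq_finsum (L := SummationFilter.unconditional ι) hf, ρ.sum_eq_one (mem_univ x)] at this

theorem sum_le_one_finset (S : Finset ι) (x : X) : ∑ i ∈ S, ρ i x ≤ 1 :=
  sum_le_hasSum S (fun i _ => ρ.nonneg i x) (ρ.hasSum x)

/-- A function that is positive where each `ρ i`, `i ∈ S`, exceeds the sum of the `ρ j`, `j ∉ S`. -/
noncomputable def dominance (S : Finset ι) (x : X) : ℝ :=
  ∏ i ∈ S, max 0 (ρ i x + ∑ k ∈ S, ρ k x - 1)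

theorem continuous_dominance (S : Finset ι) : Continuous (ρ.dominance S) :=
  continuous_finsetProd _ fun i _ => continuous_const.max
    (((ρ i).continuous.add (continuous_finsetSum _ fun k _ => (ρ k).continuous)).sub
      continuous_const)

theorem dominance_nonneg (S : Finset ι) (x : X) : 0 ≤ ρ.dominance S x :=
  Finset.prod_nonneg fun _ _ => le_max_left _ _

theorem one_lt_of_dominance {S : Finset ι} {x : X} (h : ρ.dominance S x ≠ 0) {i : ι} (hi : i ∈ S) :
    1 < ρ i x + ∑ k ∈ S, ρ k x := by
  by_contra hc
  exact Finset.prod_ne_zero_iff.1 h i hi (max_eq_left (by linarith))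

theorem pos_of_dominance {S : Finset ι} {x : X} (h : ρ.dominance S x ≠ 0) {i : ι} (hi : i ∈ S) :
    0 < ρ i x := by
  linarith [ρ.one_lt_of_dominance h hi, ρ.sum_le_one_finset S x]

theorem lt_of_dominance {S : Finset ι} {x : X} (h : ρ.dominance S x ≠ 0) {i j : ι} (hi : i ∈ S)
    (hj : j ∉ S) : ρ j x < ρ i x := by
  classical
  have := ρ.sum_le_one_finset (insert j S) x
  rw [Finset.sum_insert hj] at this
  linarith [ρ.one_lt_of_dominance h hi]

/-- Otherwise some `i ∈ S \ T` and `j ∈ T \ S` would satisfy both `ρ j x < ρ i x` and the reverse.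
So for each cardinality the supports are disjoint, and one place of `EG` serves them all. -/
theorem eq_of_dominance {S T : Finset ι} {x : X} (hS : ρ.dominance S x ≠ 0)
    (hT : ρ.dominance T x ≠ 0) (h : S.card = T.card) : S = T := by
  by_contra hne
  have h1 : ¬ S ⊆ T := fun hs => hne (Finset.eq_of_subset_of_card_le hs h.ge)
  have h2 : ¬ T ⊆ S := fun hs => hne (Finset.eq_of_subset_of_card_le hs h.le).symm
  obtain ⟨i, hiS, hiT⟩ := Finset.not_subset.1 h1
  obtain ⟨j, hjT, hjS⟩ := Finset.not_subset.1 h2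
  exact lt_asymm (ρ.lt_of_dominance hS hiS hjS) (ρ.lt_of_dominance hT hjT hiT)

theorem exists_dominance_ne_zero (x : X) :
    ∃ S : {S : Finset ι // S.Nonempty}, ρ.dominance S.1 x ≠ 0 := by
  have hf : (Function.support fun i => ρ i x).Finite := ρ.locallyFinite.point_finite x
  have hsum : ∑ i ∈ hf.toFinset, ρ i x = 1 :=
    (hasSum_sum_of_ne_finset_zero fun i hi => by simpa using hi).unique (ρ.hasSum x)
  -- For the set of all `i` with `ρ i x ≠ 0`, the sum over the complement is zero.
  refine ⟨⟨hf.toFinset, ?_⟩, ?_⟩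
  · rw [Finset.nonempty_iff_ne_empty]
    intro h
    rw [h, Finset.sum_empty] at hsum
    exact zero_ne_one hsum
  · refine Finset.prod_ne_zero_iff.2 fun i hi => ?_
    have h1 : ρ i x ≠ 0 := by simpa using hi
    have h2 : 0 < ρ i x := (ρ.nonneg i x).lt_of_ne' h1
    rw [hsum, add_sub_cancel_right, max_eq_right h2.le]
    exact h1

theorem locallyFinite_dominance :
    LocallyFinite fun S : {S : Finset ι // S.Nonempty} => Function.support (ρ.dominance S.1) := by
  intro x
  obtain ⟨t, ht, hf⟩ := ρ.locallyFinite x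
  refine ⟨t, ht, ((hf.toFinset.powerset : Finset (Finset ι)).finite_toSet.preimage
    Subtype.val_injective.injOn).subset ?_⟩
  rintro S ⟨y, hy, hyt⟩
  rw [mem_preimage, Finset.mem_coe, Finset.mem_powerset]
  intro i hi
  rw [Set.Finite.mem_toFinset]
  exact ⟨y, (ρ.pos_of_dominance hy hi).ne', hyt⟩

/-- The sum of the functions `ρ.dominance S` over the sets `S` with `n + 1` elements. -/
noncomputable def dominanceSum (n : ℕ) (x : X) : ℝ :=
  ∑ᶠ S : {S : Finset ι // S.Nonempty}, if S.1.card = n + 1 then ρ.dominance S.1 x else 0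

/-- The sum of all the functions `ρ.dominance S`. -/
noncomputable def dominanceTotal (x : X) : ℝ :=
  ∑ᶠ S : {S : Finset ι // S.Nonempty}, ρ.dominance S.1 x

theorem continuous_dominanceTotal : Continuous ρ.dominanceTotal :=
  continuous_finsum (fun S => ρ.continuous_dominance S.1) ρ.locallyFinite_dominance

theorem continuous_dominanceSum (n : ℕ) : Continuous (ρ.dominanceSum n) := by
  refine continuous_finsum (fun S => ?_) (ρ.locallyFinite_dominance.subset fun S x hx => ?_)
  · split_ifs
    · exact ρ.continuous_dominance S.1
    · exact continuous_const
  · rw [Function.mem_support] at hx ⊢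
    split_ifs at hx with h
    · exact hx
    · exact absurd rfl hx

theorem dominanceTotal_pos (x : X) : 0 < ρ.dominanceTotal x := by
  obtain ⟨S, hS⟩ := ρ.exists_dominance_ne_zero x
  exact finsum_pos (fun S => ρ.dominance_nonneg S.1 x)
    ⟨S, (ρ.dominance_nonneg S.1 x).lt_of_ne' hS⟩ (ρ.locallyFinite_dominance.point_finite x)

theorem dominanceSum_nonneg (n : ℕ) (x : X) : 0 ≤ ρ.dominanceSum n x :=
  finsum_nonneg fun S => by
    split_ifs
    · exact ρ.dominance_nonneg S.1 x
    · exact le_rfl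

theorem exists_of_dominanceSum_ne_zero {n : ℕ} {x : X} (h : ρ.dominanceSum n x ≠ 0) :
    ∃ S : {S : Finset ι // S.Nonempty}, S.1.card = n + 1 ∧ ρ.dominance S.1 x ≠ 0 := by
  by_contra! hc
  refine h (finsum_eq_zero_of_forall_eq_zero fun S => ?_)
  split_ifs with hS
  · exact hc S hS
  · rfl

theorem finite_support_dominanceSum (x : X) :
    (Function.support fun n => ρ.dominanceSum n x).Finite := by
  refine ((ρ.locallyFinite_dominance.point_finite x).image fun S => S.1.card - 1).subset ?_
  intro n hn
  obtain ⟨S, hc, hS⟩ := ρ.exists_of_dominanceSum_ne_zero hn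
  exact ⟨S, hS, by simp [hc]⟩

theorem hasSum_dominanceSum (x : X) :
    HasSum (fun n => ρ.dominanceSum n x) (ρ.dominanceTotal x) := by
  have hf := ρ.locallyFinite_dominance.point_finite x
  have h1 : ρ.dominanceTotal x = ∑ S ∈ hf.toFinset, ρ.dominance S.1 x :=
    finsum_eq_sum_of_support_subset _ fun S hS => by simpa using hS
  have h2 : ∀ n, ρ.dominanceSum n x =
      ∑ S ∈ hf.toFinset, if S.1.card = n + 1 then ρ.dominance S.1 x else 0 := fun n =>
    finsum_eq_sum_of_support_subset _ fun S hS => by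
      rw [Function.mem_support] at hS
      split_ifs at hS with h
      · simpa using hS
      · exact absurd rfl hS
  simp only [h1, h2]
  refine hasSum_sum fun S _ => ?_
  have hc : S.1.card = (S.1.card - 1) + 1 := (Nat.succ_pred_eq_of_pos S.2.card_pos).symm
  convert hasSum_single (S.1.card - 1) fun n hn => ?_ using 1
  · rw [if_pos hc]
  · exact if_neg (by omega)

end PartitionOfUnity

/-- Place `n` carries the normalized sum over sets `S` with `n + 1` elements. Its coordinate comes
from the trivialization of a chosen member of the only `S` active at the point. -/
theorem IsNumerablePrincipalBundle.nonempty_equivariantMap {G E X : Type*} [Group G]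
    [TopologicalSpace G] [TopologicalSpace E] [TopologicalSpace X] [MulAction Gᵐᵒᵖ E]
    {p : E → X} (hp : IsNumerablePrincipalBundle G p) :
    Nonempty (EquivariantMap G E (MilnorE G)) := by
  classical
  obtain ⟨ι, U, ρ, hUo, -, hUt, hρ⟩ := hp.numerable
  choose σ θ hσ hθ hθg hpσ hσθ using fun i => (hUt i).exists_section hp.toIsPrincipalSpace
  have hpg : ∀ z (g : G), p (MulOpposite.op g • z) = p z := fun z g =>
    ((hp.fiber _ _).2 ⟨g, rfl⟩).symm
  have hmem : ∀ (S : {S : Finset ι // S.Nonempty}) x, ρ.dominance S.1 x ≠ 0 →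
      x ∈ U S.2.choose := fun S x h =>
    hρ _ (subset_tsupport _ (ρ.pos_of_dominance h S.2.choose_spec).ne')
  let Θ : ℕ → E → G := fun n z =>
    if h : ∃ S : {S : Finset ι // S.Nonempty}, S.1.card = n + 1 ∧ ρ.dominance S.1 (p z) ≠ 0
    then θ h.choose.2.choose z else 1
  have hΘ : ∀ (S : {S : Finset ι // S.Nonempty}) n z, S.1.card = n + 1 →
      ρ.dominance S.1 (p z) ≠ 0 → Θ n z = θ S.2.choose z := by
    intro S n z hc hS
    have h : ∃ S : {S : Finset ι // S.Nonempty}, S.1.card = n + 1 ∧ ρ.dominance S.1 (p z) ≠ 0 :=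
      ⟨S, hc, hS⟩
    have : h.choose = S := Subtype.ext
      (ρ.eq_of_dominance h.choose_spec.2 hS (h.choose_spec.1.trans hc.symm))
    exact (dif_pos h).trans (by rw [this])
  have hne : ∀ {n z}, 0 < ρ.dominanceSum n (p z) / ρ.dominanceTotal (p z) →
      ρ.dominanceSum n (p z) ≠ 0 := fun h h' => by
    rw [h', zero_div] at h
    exact lt_irrefl _ h
  obtain ⟨f, -⟩ := MilnorE.exists_equivariantMap
    (fun n z => ρ.dominanceSum n (p z) / ρ.dominanceTotal (p z)) Θ
    (fun n => ((ρ.continuous_dominanceSum n).comp hp.continuous).div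
      (ρ.continuous_dominanceTotal.comp hp.continuous) fun z => (ρ.dominanceTotal_pos _).ne')
    (fun n z => div_nonneg (ρ.dominanceSum_nonneg n _) (ρ.dominanceTotal_pos _).le)
    (fun z => (ρ.finite_support_dominanceSum (p z)).subset fun n hn h => hn (by
      simp only at h
      simp only [h, zero_div]))
    (fun z => by
      have := (ρ.hasSum_dominanceSum (p z)).div_const (ρ.dominanceTotal (p z))
      rwa [div_self (ρ.dominanceTotal_pos _).ne'] at this)
    (fun n z g => by simp only [hpg])
    (fun n z h => by
      obtain ⟨S, hc, hS⟩ := ρ.exists_of_dominanceSum_ne_zero (hne h)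
      have hc' : ContinuousAt (θ S.2.choose) z := (hθ S.2.choose).continuousAt
        (((hUo _).preimage hp.continuous).mem_nhds (hmem S _ hS))
      refine hc'.congr ?_
      filter_upwards [((ρ.continuous_dominance S.1).comp hp.continuous).continuousAt.eventually_ne
        hS] with y hy
      exact (hΘ S n y hc hy).symm)
    (fun n z g h => by
      obtain ⟨S, hc, hS⟩ := ρ.exists_of_dominanceSum_ne_zero (hne h)
      rw [hΘ S n z hc hS, hΘ S n _ hc (by rwa [hpg]), hθg _ z g (hmem S _ hS)])
  exact ⟨f⟩

/-! ### Homotopies of spaces of equivariant maps to `EG` -/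

namespace EquivariantMap

open unitInterval

variable {G E : Type*} [Group G] [TopologicalSpace G] [TopologicalSpace E] [MulAction Gᵐᵒᵖ E]

/-- Composition with the stages of the deformation `MilnorE.shift`. -/
noncomputable def shift (s : I) (f : EquivariantMap G E (MilnorE G)) :
    EquivariantMap G E (MilnorE G) :=
  ⟨(⟨fun q : I × MilnorE G => MilnorE.shift q.1 q.2, MilnorE.continuous_shift⟩ : C(_, _)).comp
    ((ContinuousMap.const E s).prodMk f.1), fun g z => by
      change MilnorE.shift s (f.1 (MulOpposite.op g • z)) = _
      rw [f.2, MilnorE.shift_smul]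
      rfl⟩

theorem shift_apply (s : I) (f : EquivariantMap G E (MilnorE G)) (z : E) :
    (shift s f).1 z = MilnorE.shift s (f.1 z) := rfl

theorem continuous_shift :
    Continuous fun q : I × EquivariantMap G E (MilnorE G) => shift q.1 q.2 :=
  (((ContinuousMap.continuous_postcomp _).comp ContinuousMap.continuous_prodMk_const).comp
    (continuous_fst.prodMk (continuous_subtype_val.comp continuous_snd))).subtype_mk _

/-- The pointwise join with the map `φ` in the proportion given by `s` times the function `l`. -/
noncomputable def join (φ : EquivariantMap G E (MilnorE G)) (l : C(E, I))
    (hl : ∀ (g : G) z, l (MulOpposite.op g • z) = l z) (s : I)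
    (f : EquivariantMap G E (MilnorE G)) : EquivariantMap G E (MilnorE G) :=
  ⟨(⟨fun q : (I × MilnorE G) × (MilnorE G × I) => MilnorE.join q.1.2 q.2.1 (q.1.1 * q.2.2),
      MilnorE.continuous_join.comp ((continuous_snd.comp continuous_fst).prodMk
        ((continuous_fst.comp continuous_snd).prodMk ((continuous_fst.comp continuous_fst).mul
          (continuous_snd.comp continuous_snd))))⟩ : C(_, _)).comp
    (((ContinuousMap.const E s).prodMk f.1).prodMk (φ.1.prodMk l)), fun g z => by
      change MilnorE.join (f.1 (MulOpposite.op g • z)) (φ.1 (MulOpposite.op g • z))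
        (s * l (MulOpposite.op g • z)) = _
      rw [f.2, φ.2, hl, ← MilnorE.join_smul]
      rfl⟩

theorem join_apply (φ : EquivariantMap G E (MilnorE G)) (l : C(E, I))
    (hl : ∀ (g : G) z, l (MulOpposite.op g • z) = l z) (s : I)
    (f : EquivariantMap G E (MilnorE G)) (z : E) :
    (join φ l hl s f).1 z = MilnorE.join (f.1 z) (φ.1 z) (s * l z) := rfl

theorem continuous_join [IsTopologicalGroup G] (φ : EquivariantMap G E (MilnorE G)) (l : C(E, I))
    (hl : ∀ (g : G) z, l (MulOpposite.op g • z) = l z) :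
    Continuous fun q : I × EquivariantMap G E (MilnorE G) => join φ l hl q.1 q.2 :=
  ((((ContinuousMap.continuous_postcomp _).comp (ContinuousMap.continuous_prodMk_left _)).comp
    ContinuousMap.continuous_prodMk_const).comp
    (continuous_fst.prodMk (continuous_subtype_val.comp continuous_snd))).subtype_mk _

/-- The identity of a set of equivariant maps is homotopic to the pointwise join with `φ` in the
proportion given by `l`, if the set is stable under the homotopies that this involves. -/
theorem exists_homotopic_join [IsTopologicalGroup G] (φ : EquivariantMap G E (MilnorE G))
    (l : C(E, I)) (hl : ∀ (g : G) z, l (MulOpposite.op g • z) = l z)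
    (S : Set (EquivariantMap G E (MilnorE G))) (hS : ∀ s, ∀ f ∈ S, shift s f ∈ S)
    (hS' : ∀ s, ∀ f ∈ S, join φ l hl s f ∈ S) :
    ∃ J : C(S, S), (∀ f z, (J f).1.1 z = MilnorE.join (f.1.1 z) (φ.1 z) (l z)) ∧
      (ContinuousMap.id S).Homotopic J := by
  let H : C(I × S, S) := ⟨fun q => ⟨shift q.1 q.2.1, hS q.1 _ q.2.2⟩,
    (continuous_shift.comp (continuous_fst.prodMk
      (continuous_subtype_val.comp continuous_snd))).subtype_mk _⟩
  let H' : C(I × S, S) := ⟨fun q => ⟨join φ l hl q.1 q.2.1, hS' q.1 _ q.2.2⟩,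
    ((continuous_join φ l hl).comp (continuous_fst.prodMk
      (continuous_subtype_val.comp continuous_snd))).subtype_mk _⟩
  let J : C(S, S) := H'.comp ((ContinuousMap.const S 1).prodMk (ContinuousMap.id S))
  have h0 : (ContinuousMap.id S).Homotopic
      (H.comp ((ContinuousMap.const S 1).prodMk (ContinuousMap.id S))) :=
    ⟨⟨H, fun f => Subtype.ext (Subtype.ext (ContinuousMap.ext fun z =>
      MilnorE.shift_zero (f.1.1 z))), fun f => rfl⟩⟩
  have h1 : (H.comp ((ContinuousMap.const S 1).prodMk (ContinuousMap.id S))).Homotopic J :=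
    ⟨⟨H', fun f => Subtype.ext (Subtype.ext (ContinuousMap.ext fun z => by
      change MilnorE.join (f.1.1 z) (φ.1 z) (0 * l z) = MilnorE.shift 1 (f.1.1 z)
      rw [zero_mul, MilnorE.shift_one])), fun f => rfl⟩⟩
  refine ⟨J, fun f z => ?_, h0.trans h1⟩
  change MilnorE.join (f.1.1 z) (φ.1 z) (1 * l z) = _
  rw [one_mul]

/-- Sliding with `l = 1` ends at a map that no longer involves `f`. -/
theorem contractibleSpace [IsTopologicalGroup G] (φ : EquivariantMap G E (MilnorE G)) :
    ContractibleSpace (EquivariantMap G E (MilnorE G)) := by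
  obtain ⟨J, hJ, hid⟩ := exists_homotopic_join φ (ContinuousMap.const E 1) (fun _ _ => rfl) univ
    (fun _ _ _ => mem_univ _) fun _ _ _ => mem_univ _
  have hc : J = ContinuousMap.const _ (J ⟨φ, mem_univ _⟩) := by
    refine ContinuousMap.ext fun f => Subtype.ext (Subtype.ext (ContinuousMap.ext fun z => ?_))
    rw [ContinuousMap.const_apply, hJ, hJ]
    exact MilnorE.join_one _ _ _
  have : ContractibleSpace (univ : Set (EquivariantMap G E (MilnorE G))) :=
    (contractible_iff_id_nullhomotopic _).2 ⟨_, hc ▸ hid⟩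
  exact (Homeomorph.Set.univ _).symm.contractibleSpace

end EquivariantMap

/-! ### Pointed equivariant maps -/

section Pointed

open unitInterval

universe u

variable {G E : Type*} {X : Type u} [Group G] [TopologicalSpace G] [TopologicalSpace E]
  [TopologicalSpace X] [MulAction Gᵐᵒᵖ E] {p : E → X}

/-- Over a locally compact base the evaluation of equivariant maps is continuous, even if the
total space is not locally compact. -/
theorem IsNumerablePrincipalBundle.continuous_eval (hp : IsNumerablePrincipalBundle G p)
    [LocallyCompactSpace X] {A : Type*} [TopologicalSpace A] [MulAction Gᵐᵒᵖ A]
    [ContinuousSMul Gᵐᵒᵖ A] : Continuous fun q : EquivariantMap G E A × E => q.1.1 q.2 := by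
  obtain ⟨ι, U, -, hUo, hUc, hUt, -⟩ := hp.numerable
  refine continuous_iff_continuousAt.2 fun q => ?_
  obtain ⟨i, hi⟩ := mem_iUnion.1 (hUc.symm ▸ mem_univ (p q.2))
  obtain ⟨τ, θ, hτ, hθ, -, -, hτθ⟩ := (hUt i).exists_section hp.toIsPrincipalSpace
  have := (hUo i).locallyCompactSpace
  let W : Set (EquivariantMap G E A × E) := {q | p q.2 ∈ U i}
  have hW : IsOpen W := (hUo i).preimage (hp.continuous.comp continuous_snd)
  refine ContinuousOn.continuousAt (s := W) ?_ (hW.mem_nhds hi)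
  rw [continuousOn_iff_continuous_domRestrict]
  -- Since `f z = f (τ (p z)) · θ z`, it suffices to evaluate `f ∘ τ'`, whose source is locally
  -- compact.
  let τ' : C(U i, E) := ⟨fun x => τ x, continuousOn_iff_continuous_domRestrict.1 hτ⟩
  have h1 : Continuous fun w : W => θ w.1.2 :=
    hθ.comp_continuous (continuous_snd.comp continuous_subtype_val) fun w => w.2
  have h2 : Continuous fun w : W => w.1.1.1.comp τ' :=
    (ContinuousMap.continuous_precomp τ').comp
      (continuous_subtype_val.comp (continuous_fst.comp continuous_subtype_val))
  have h3 : Continuous fun w : W => (⟨p w.1.2, w.2⟩ : U i) :=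
    (hp.continuous.comp (continuous_snd.comp continuous_subtype_val)).subtype_mk _
  refine ((MulOpposite.continuous_op.comp h1).smul (h2.eval h3)).congr fun w => ?_
  change MulOpposite.op (θ w.1.2) • w.1.1.1 (τ (p w.1.2)) = w.1.1.1 w.1.2
  rw [← w.1.1.2, hτθ _ w.2]

/-- A cofibration `{x₀} ⊆ X` yields a deformation of `X` rel `x₀` that at its end is constant on
a neighbourhood of `x₀` given by a function. -/
theorem IsCofibrationInclusion.exists_deformation {x₀ : X}
    (h : IsCofibrationInclusion ({x₀} : Set X)) :
    ∃ (D : C(X × I, X)) (v : C(X, I)), (∀ x, D (x, 0) = x) ∧ (∀ s, D (x₀, s) = x₀) ∧ v x₀ = 1 ∧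
      ∀ x, v x ≠ 0 → D (x, 1) = x₀ := by
  -- Homotopy extension into this subspace gives a retraction `K` of `X × I` onto it. Its components
  -- yield `D` and `v`; where `v x ≠ 0`, the point `K (x, 1)` lies over `x₀`.
  let Z : Set (X × I) := {q | q.2 = 0 ∨ q.1 = x₀}
  obtain ⟨K, hK, hK'⟩ := h Z
    ⟨fun x => ⟨(x, 0), Or.inl rfl⟩, (continuous_id.prodMk continuous_const).subtype_mk _⟩
    ⟨fun q => ⟨(q.1, q.2), Or.inr q.1.2⟩,
      ((continuous_subtype_val.comp continuous_fst).prodMk continuous_snd).subtype_mk _⟩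
    fun _ => rfl
  refine ⟨⟨fun q => (K q).1.1, continuous_fst.comp (continuous_subtype_val.comp K.continuous)⟩,
    ⟨fun x => (K (x, 1)).1.2, continuous_snd.comp (continuous_subtype_val.comp
      (K.continuous.comp (continuous_id.prodMk continuous_const)))⟩, fun x => ?_, fun s => ?_, ?_,
      fun x hx => (K (x, 1)).2.resolve_left hx⟩
  · change (K (x, 0)).1.1 = x
    rw [hK]
    rfl
  · exact congrArg (fun z : Z => z.1.1) (hK' ⟨x₀, rfl⟩ s)
  · exact congrArg (fun z : Z => z.1.2) (hK' ⟨x₀, rfl⟩ 1)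

/-- A cofibration `{p e} ⊆ X` yields an equivariant deformation of `E` rel `e` that at its end maps
a neighbourhood of the fibre of `e` to this fibre. -/
theorem IsNumerablePrincipalBundle.exists_deformation [IsTopologicalGroup G]
    [ContinuousSMul Gᵐᵒᵖ E] (hp : IsNumerablePrincipalBundle G p) (e : E)
    (h : IsCofibrationInclusion ({p e} : Set X)) :
    ∃ (D : C(I × E, E)) (l : C(E, I)) (η : E → G), (∀ z, D (0, z) = z) ∧
      (∀ s (g : G) z, D (s, MulOpposite.op g • z) = MulOpposite.op g • D (s, z)) ∧
      (∀ s, D (s, e) = e) ∧ (∀ (g : G) z, l (MulOpposite.op g • z) = l z) ∧ l e = 0 ∧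
      (∀ z, l z ≠ 1 → ContinuousAt η z) ∧
      (∀ z (g : G), l z ≠ 1 → η (MulOpposite.op g • z) = η z * g) ∧ η e = 1 ∧
      ∀ z, l z ≠ 1 → D (1, z) = MulOpposite.op (η z) • e := by
  classical
  obtain ⟨d, v, hd0, hde, hve, hv⟩ := h.exists_deformation
  obtain ⟨ι, U, ρ, hUo, -, hUt, hρ⟩ := hp.numerable
  obtain ⟨i, hi⟩ := ρ.exists_pos (mem_univ (p e))
  obtain ⟨τ, θ, hτ, hθ, hθg, hpτ, hτθ⟩ := (hUt i).exists_section hp.toIsPrincipalSpace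
  have hpg : ∀ z (g : G), p (MulOpposite.op g • z) = p z := fun z g =>
    ((hp.fiber _ _).2 ⟨g, rfl⟩).symm
  set c := ρ i (p e) with hc
  -- Positivity of `m x` keeps the whole track of `x` in the trivializing set `U i`, so that the
  -- track lifts with `θ` held fixed.
  let m : X → ℝ := fun x => sInf ((fun s : I => ρ i (d (x, s))) '' univ)
  have hmc : Continuous m :=
    isCompact_univ.continuous_sInf (f := fun x (s : I) => ρ i (d (x, s)))
      ((ρ i).continuous.comp d.continuous)
  have hm_le : ∀ x s, m x ≤ ρ i (d (x, s)) := fun x s =>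
    csInf_le ⟨0, by rintro _ ⟨s, -, rfl⟩; exact ρ.nonneg i _⟩ ⟨s, mem_univ s, rfl⟩
  have hme : m (p e) = c := by
    have : (fun s : I => ρ i (d (p e, s))) '' univ = {c} := by
      simp only [hde, ← hc]
      exact univ_nonempty.image_const c
    change sInf _ = c
    rw [this, csInf_singleton]
  have hU : ∀ x, 0 < ρ i x → x ∈ U i := fun x hx => hρ i (subset_tsupport _ hx.ne')
  have hmU : ∀ x s, 0 < m x → d (x, s) ∈ U i := fun x s hx => hU _ (hx.trans_le (hm_le x s))
  have hmU' : ∀ x, 0 < m x → x ∈ U i := fun x hx => hd0 x ▸ hmU x 0 hx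
  -- The cutoff stops the deformation where `m ≤ c / 3`, so the lift extends by the identity, and
  -- runs it in full where `m ≥ 2 * c / 3`.
  let χ : X → I := fun x => projIcc (0 : ℝ) 1 zero_le_one (3 * m x / c - 1)
  have hχ : Continuous χ := continuous_projIcc.comp
    (((continuous_const.mul hmc).div_const c).sub continuous_const)
  have hχ0 : ∀ x, m x ≤ c / 3 → χ x = 0 := fun x hx => projIcc_of_le_left _ (by
    rw [sub_nonpos, div_le_one hi]
    linarith)
  have hχ1 : ∀ x, 2 * c / 3 ≤ m x → χ x = 1 := fun x hx => projIcc_of_right_le _ (by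
    rw [le_sub_iff_add_le, le_div_iff₀ hi]
    linarith)
  let D : I × E → E := fun q => if 0 < m (p q.2) then
    MulOpposite.op (θ q.2) • τ (d (p q.2, q.1 * χ (p q.2))) else q.2
  have hDpos : ∀ s z, 0 < m (p z) →
      D (s, z) = MulOpposite.op (θ z) • τ (d (p z, s * χ (p z))) := fun s z hz => if_pos hz
  have hDid : ∀ s z, m (p z) ≤ c / 3 → D (s, z) = z := fun s z hz => by
    by_cases hz' : 0 < m (p z)
    · rw [hDpos s z hz', hχ0 _ hz, mul_zero, hd0, hτθ z (hmU' _ hz')]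
    · exact if_neg hz'
  have hmp : Continuous fun q : I × E => m (p q.2) :=
    hmc.comp (hp.continuous.comp continuous_snd)
  have hD : Continuous D := continuous_iff_continuousAt.2 fun q => by
    by_cases hq : 0 < m (p q.2)
    · have h1 : ContinuousAt (fun q : I × E => MulOpposite.op (θ q.2)) q :=
        MulOpposite.continuous_op.continuousAt.comp (ContinuousAt.comp (f := Prod.snd)
          (hθ.continuousAt (((hUo i).preimage hp.continuous).mem_nhds (hmU' _ hq)))
          continuousAt_snd)
      have h2 : Continuous fun q : I × E => d (p q.2, q.1 * χ (p q.2)) :=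
        d.continuous.comp ((hp.continuous.comp continuous_snd).prodMk
          (continuous_fst.mul (hχ.comp (hp.continuous.comp continuous_snd))))
      have h3 : ContinuousAt (fun q : I × E => τ (d (p q.2, q.1 * χ (p q.2)))) q :=
        ContinuousAt.comp (f := fun q : I × E => d (p q.2, q.1 * χ (p q.2)))
          (hτ.continuousAt ((hUo i).mem_nhds (hmU _ _ hq))) h2.continuousAt
      refine (h1.smul h3).congr ?_
      filter_upwards [hmp.continuousAt.eventually (lt_mem_nhds hq)] with y hy
      exact (hDpos y.1 y.2 hy).symm
    · have hq' : m (p q.2) < c / 3 := by linarith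
      refine continuousAt_snd.congr ?_
      filter_upwards [hmp.continuousAt.eventually (gt_mem_nhds hq')] with y hy
      exact (hDid y.1 y.2 hy.le).symm
  have hme0 : 0 < m (p e) := hme.symm ▸ hi
  -- `l z ≠ 1` forces both `v (p z) ≠ 0` and `m (p z) > 2 * c / 3`: the deformation then runs to its
  -- end, at `p e`. At `e` both terms of the minimum are `1`.
  let l : C(E, I) := ⟨fun z => projIcc (0 : ℝ) 1 zero_le_one
    (1 - min (v (p z) : ℝ) (3 * m (p z) / c - 2)), continuous_projIcc.comp
      (continuous_const.sub ((continuous_subtype_val.comp (v.continuous.comp hp.continuous)).min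
        (((continuous_const.mul (hmc.comp hp.continuous)).div_const c).sub continuous_const)))⟩
  have hl : ∀ z, l z ≠ 1 → v (p z) ≠ 0 ∧ 2 * c / 3 ≤ m (p z) := fun z hz => by
    have h1 : 0 < min (v (p z) : ℝ) (3 * m (p z) / c - 2) := by
      by_contra hneg
      exact hz (projIcc_of_right_le zero_le_one (by linarith))
    obtain ⟨h2, h3⟩ := lt_min_iff.1 h1
    refine ⟨fun h0 => by rw [h0] at h2; exact lt_irrefl _ h2, ?_⟩
    rw [sub_pos, lt_div_iff₀ hi] at h3
    linarith
  have hlm : ∀ z, l z ≠ 1 → 0 < m (p z) := fun z hz => by linarith [(hl z hz).2]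
  refine ⟨⟨D, hD⟩, l, fun z => (θ e)⁻¹ * θ z, fun z => ?_, fun s g z => ?_, fun s => ?_,
    fun g z => ?_, ?_, fun z hz => ?_, fun z g hz => ?_, inv_mul_cancel _, fun z hz => ?_⟩
  · change D (0, z) = z
    by_cases hz : 0 < m (p z)
    · rw [hDpos _ _ hz, zero_mul, hd0, hτθ z (hmU' _ hz)]
    · exact if_neg hz
  · change D (s, MulOpposite.op g • z) = MulOpposite.op g • D (s, z)
    by_cases hz : 0 < m (p z)
    · rw [hDpos _ _ hz, hDpos _ _ ((hpg z g).symm ▸ hz), hpg, hθg z g (hmU' _ hz),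
        MulOpposite.op_mul, mul_smul]
    · have hz' : m (p z) ≤ c / 3 := by linarith
      rw [hDid _ _ hz', hDid _ _ ((hpg z g).symm ▸ hz')]
  · change D (s, e) = e
    rw [hDpos _ _ hme0, hde, hτθ e (hmU' _ hme0)]
  · change projIcc (0 : ℝ) 1 zero_le_one (1 - min (v (p (MulOpposite.op g • z)) : ℝ)
      (3 * m (p (MulOpposite.op g • z)) / c - 2)) = _
    rw [hpg]
    rfl
  · refine projIcc_of_le_left zero_le_one ?_
    rw [hve, hme, mul_div_cancel_right₀ _ hi.ne', Icc.coe_one]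
    norm_num
  · exact continuousAt_const.mul
      (hθ.continuousAt (((hUo i).preimage hp.continuous).mem_nhds (hmU' _ (hlm z hz))))
  · change (θ e)⁻¹ * θ _ = _
    rw [hθg z g (hmU' _ (hlm z hz)), mul_assoc]
  · change D (1, z) = _
    rw [hDpos _ _ (hlm z hz), hχ1 _ (hl z hz).2, one_mul, hv _ (hl z hz).1]
    have he : MulOpposite.op (θ e) • τ (p e) = e := hτθ e (hmU' _ hme0)
    have hz' : θ z = θ e * ((θ e)⁻¹ * θ z) := (mul_inv_cancel_left _ _).symm
    conv_lhs => rw [hz', MulOpposite.op_mul, mul_smul, he]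

/-- There is a pointed equivariant map, built from an unpointed one and from a local one near the
fibre of the base point. -/
theorem EquivariantMap.exists_pointed (φ : EquivariantMap G E (MilnorE G)) (e : E)
    (l : C(E, I)) (η : E → G) (hl : ∀ (g : G) z, l (MulOpposite.op g • z) = l z) (hle : l e = 0)
    (hη : ∀ z, l z ≠ 1 → ContinuousAt η z)
    (hηg : ∀ z (g : G), l z ≠ 1 → η (MulOpposite.op g • z) = η z * g) (hηe : η e = 1) :
    ∃ f : EquivariantMap G E (MilnorE G), f.1 e = MilnorE.base G := by
  -- Place `0` holds the local map `η`, and `φ` is moved up by one place; at `e` only place `0`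
  -- remains, with coordinate `η e = 1`.
  let T : ℕ → E → ℝ := fun n z => Nat.casesOn n (1 - (l z : ℝ)) fun n => l z * (φ.1 z).t n
  let Θ : ℕ → E → G := fun n z => Nat.casesOn n (η z) fun n => (φ.1 z).coord n
  have hT0 : ∀ z, 0 < T 0 z → l z ≠ 1 := fun z hz h => by
    change 0 < 1 - (l z : ℝ) at hz
    rw [h, Icc.coe_one, sub_self] at hz
    exact lt_irrefl _ hz
  have hTs : ∀ n z, 0 < T (n + 1) z → 0 < (φ.1 z).t n := fun n z hz =>
    ((φ.1 z).nonneg n).lt_of_ne' (right_ne_zero_of_mul (ne_of_gt hz))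
  have hlc : Continuous fun z => (l z : ℝ) := continuous_subtype_val.comp l.continuous
  refine (MilnorE.exists_equivariantMap T Θ ?_ ?_ ?_ ?_ ?_ ?_ ?_).elim ?_
  · rintro (_ | n)
    · exact continuous_const.sub hlc
    · exact hlc.mul ((MilnorE.continuous_t n).comp φ.1.continuous)
  · rintro (_ | n) z
    · exact sub_nonneg.2 (l z).2.2
    · exact mul_nonneg (l z).2.1 ((φ.1 z).nonneg n)
  · refine fun z => (((φ.1 z).finite.image Nat.succ).insert 0).subset ?_
    rintro (_ | n) hn
    · exact mem_insert _ _
    · exact mem_insert_of_mem _ ⟨n, right_ne_zero_of_mul hn, rfl⟩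
  · intro z
    have h1 : HasSum (fun n => T (n + 1) z) (l z * 1) := (φ.1 z).hasSum_t.mul_left _
    have h2 := HasSum.zero_add (f := fun n => T n z) h1
    convert h2 using 1
    change (1 : ℝ) = 1 - l z + l z * 1
    ring
  · rintro (_ | n) z g
    · change 1 - (l _ : ℝ) = 1 - l z
      rw [hl]
    · change (l _ : ℝ) * _ = l z * _
      rw [hl, φ.2, MilnorE.smul_t]
  · rintro (_ | n) z hz
    · exact hη z (hT0 z hz)
    · exact ContinuousAt.comp (f := φ.1) (MilnorE.continuousAt_coord (hTs n z hz))
        φ.1.continuous.continuousAt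
  · rintro (_ | n) z g hz
    · exact hηg z g (hT0 z hz)
    · change (φ.1 _).coord n = (φ.1 z).coord n * g
      rw [φ.2, MilnorE.coord_smul g (hTs n z hz)]
  · rintro f ⟨hft, hfg⟩
    refine ⟨f, MilnorE.ext_coord (fun n => ?_) fun n hn => ?_⟩
    · rw [hft, MilnorE.base_t]
      cases n with
      | zero => simp [T, hle]
      | succ n => simp [T, hle]
    · rw [hft] at hn
      cases n with
      | zero => rw [hfg _ _ hn, MilnorE.coord_base_zero]; exact hηe
      | succ n => simp [T, hle] at hn

theorem IsNumerablePrincipalBundle.contractibleSpace_pointedEquivariantMap [IsTopologicalGroup G]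
    [ContinuousSMul Gᵐᵒᵖ E] (hp : IsNumerablePrincipalBundle G p) (e : E) [LocallyCompactSpace X]
    (h : IsCofibrationInclusion ({p e} : Set X)) :
    ContractibleSpace (PointedEquivariantMap G e (MilnorE.base G)) := by
  obtain ⟨φ⟩ := hp.nonempty_equivariantMap
  obtain ⟨D, l, η, hD0, hDg, hDe, hl, hle, hη, hηg, hηe, hD1⟩ := hp.exists_deformation e h
  obtain ⟨f₀, hf₀⟩ := EquivariantMap.exists_pointed φ e l η hl hle hη hηg hηe
  let S : Set (EquivariantMap G E (MilnorE G)) := {f | f.1 e = MilnorE.base G}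
  obtain ⟨J, hJ, hid⟩ := EquivariantMap.exists_homotopic_join φ l hl S
    (fun s f (hf : f.1 e = _) => by
      change (EquivariantMap.shift s f).1 e = _
      rw [EquivariantMap.shift_apply, hf, MilnorE.shift_base])
    (fun s f (hf : f.1 e = _) => by
      change (EquivariantMap.join φ l hl s f).1 e = _
      rw [EquivariantMap.join_apply, hf, hle, mul_zero, MilnorE.join_base])
  have hev : Continuous fun q : (I × S) × E => q.1.2.1.1 (D (q.1.1, q.2)) :=
    (hp.continuous_eval (A := MilnorE G)).comp
      ((continuous_subtype_val.comp (continuous_snd.comp continuous_fst)).prodMk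
        (D.continuous.comp ((continuous_fst.comp continuous_fst).prodMk continuous_snd)))
  let C : C(I × S, C(E, MilnorE G)) := ContinuousMap.curry ⟨_, hev⟩
  have hCg : ∀ (q : I × S) (g : G) z, C q (MulOpposite.op g • z) = MulOpposite.op g • C q z := by
    intro q g z
    change q.2.1.1 (D (q.1, MulOpposite.op g • z)) = _
    rw [hDg, q.2.1.2]
    rfl
  have hCe : ∀ q : I × S, C q e = MilnorE.base G := by
    intro q
    change q.2.1.1 (D (q.1, e)) = _
    rw [hDe]
    exact q.2.2
  let H : C(I × S, S) := ⟨fun q => ⟨⟨C q, hCg q⟩, hCe q⟩,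
    (C.continuous.subtype_mk hCg).subtype_mk hCe⟩
  let A : C(S, S) := H.comp ((ContinuousMap.const S 1).prodMk (ContinuousMap.id S))
  have hA : (ContinuousMap.id S).Homotopic A :=
    ⟨⟨H, fun f => Subtype.ext (Subtype.ext (ContinuousMap.ext fun z => by
      change f.1.1 (D (0, z)) = f.1.1 z
      rw [hD0])), fun f => rfl⟩⟩
  -- Where `l z = 1` the join forgets `f`; elsewhere `f (D (1, z))` is the base point times `η z`
  -- for every pointed `f`.
  have hc : J.comp A = ContinuousMap.const S (J (A ⟨f₀, hf₀⟩)) := by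
    refine ContinuousMap.ext fun f => Subtype.ext (Subtype.ext (ContinuousMap.ext fun z => ?_))
    rw [ContinuousMap.comp_apply, ContinuousMap.const_apply, hJ, hJ]
    change MilnorE.join (f.1.1 (D (1, z))) _ _ = MilnorE.join (f₀.1 (D (1, z))) _ _
    by_cases hz : l z = 1
    · rw [hz]
      exact MilnorE.join_one _ _ _
    · rw [hD1 z hz, f.1.2, f₀.2, hf₀, show f.1.1 e = MilnorE.base G from f.2]
  have hJA : (ContinuousMap.id S).Homotopic (J.comp A) := hA.trans (hid.comp (.refl A))
  exact (contractible_iff_id_nullhomotopic S).2 ⟨_, hc ▸ hJA⟩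

end Pointed

theorem mainTheorem9 {G E X : Type*} [Group G] [TopologicalSpace G] [IsTopologicalGroup G]
    [TopologicalSpace E] [TopologicalSpace X] [MulAction Gᵐᵒᵖ E] [ContinuousSMul Gᵐᵒᵖ E]
    (p : E → X) (hp : IsNumerablePrincipalBundle G p) :
    ContractibleSpace (EquivariantMap G E (MilnorE G)) ∧
    ∀ e : E, LocallyCompactSpace X → IsCofibrationInclusion ({p e} : Set X) →
      IsWeaklyContractible (PointedEquivariantMap G e (MilnorE.base G)) := by
  obtain ⟨φ⟩ := hp.nonempty_equivariantMap
  refine ⟨EquivariantMap.contractibleSpace φ, fun e _ he => ?_⟩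
  have := hp.contractibleSpace_pointedEquivariantMap e he
  exact ContractibleSpace.isWeaklyContractible
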